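/- Let $n\ge 0$ and write $\mathbb T^n=(\mathbb R/\mathbb Z)^n$ with normalized Haar measure. For $w\in\mathbb T^n$, $m\in\mathbb Z^n$ and $g:\mathbb Z^n\to\mathbb C$ put $M_wT_mg(k)=e^{2\pi i w\cdot k}g(k-m)$ and $$V_gf(m,w)=\sum_{k\in\mathbb Z^n}f(k)\,\overline{M_wT_mg(k)} .$$ Fix a non-zero rapidly decreasing window $\varphi\in\mathcal S(\mathbb Z^n)$; $M^1(\mathbb Z^n)$ is the space of tempered distributions $f$ on $\mathbb Z^n$ (sequences of at most polynomial growth) with $V_\varphi f\in L^1(\mathbb Z^n\times\mathbb T^n)$. Let $\mathcal S(\mathbb Z^n\times\mathbb T^n)$ be the space of functions that are smooth on $\mathbb T^n$ and, with all their torus derivatives, rapidly decreasing in the $\mathbb Z^n$-variable uniformly on $\mathbb T^n$. Fix a non-zero window $\Phi\in\mathcal S(\mathbb Z^n\times\mathbb T^n)$; for $1\le p\le\infty$, $M^p(\mathbb Z^n\times\mathbb T^n)$ is the space of $\sigma\in\mathcal S'(\mathbb Z^n\times\mathbb T^n)$ whose short-time Fourier transform $V_\Phi\sigma(z,\zeta)=\langle\sigma,M_\zeta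 T_z\Phi\rangle$ lies in $L^p\big((\mathbb Z^n\times\mathbb T^n)\times(\mathbb T^n\times\mathbb Z^n)\big)$, with norm $\|V_\Phi\sigma\|_{L^p}$. For a function $u\in M^1\cap M^\infty$ (which is in particular integrable) and $g_1,g_2\in M^1(\mathbb Z^n)$, the localization operator on $\ell^2(\mathbb Z^n)$ is $$\mathfrak L^{g_1,g_2}_{u}f(k)=\sum_{m\in\mathbb Z^n}\int_{\mathbb T^n}u(m,w)\,V_{g_1}f(m,w)\,M_wT_mg_2(k)\,dw,\qquad k\in\mathbb Z^n .$$ For $\sigma\in M^p(\mathbb Z^n\times\mathbb T^n)$, $1\le p<\infty$, the operator $\mathfrak L^{g_1,g_2}_\sigma$ is defined by continuous extension: it is the limit in $\mathcal B(\ell^2(\mathbb Z^n))$ of $\mathfrak L^{g_1,g_2}_{u_i}$ for every sequence of functions $u_i\in M^1\cap M^\infty$ with $u_i\to\sigma$ in $M^p$. **Theorem.** Let $1\le p<\infty$, $\sigma\in M^p(\mathbb Z^n\times\mathbb T^n)$ and $g_1,g_2\in M^1(\mathbb Z^n)$. Then $\mathfrak L^{g_1,g_2}_\sigma$ is well defined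 by the above (approximating sequences exist, the operators $\mathfrak L^{g_1,g_2}_{u_i}$ are bounded, and they converge in operator norm to a limit that does not depend on the sequence), and $\mathfrak L^{g_1,g_2}_\sigma:\ell^2(\mathbb Z^n)\to\ell^2(\mathbb Z^n)$ is compact. If moreover $\sigma\in M^1(\mathbb Z^n\times\mathbb T^n)$, then $\mathfrak L^{g_1,g_2}_\sigma$ is of trace class, that is, compact with summable singular values (the eigenvalues of $|\mathfrak L^{g_1,g_2}_\sigma|$ counted with multiplicity). -/

import Mathlib

open scoped ContDiff
open MeasureTheory

namespace DiscreteLoc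

noncomputable section

/-! ### The groups `ℤⁿ`, `𝕋ⁿ`, their Haar measures and characters -/

/-- The lattice `ℤⁿ`. -/
abbrev Zn (n : ℕ) : Type := Fin n → ℤ

/-- The torus `𝕋ⁿ = (ℝ/ℤ)ⁿ`. -/
abbrev Tn (n : ℕ) : Type := UnitAddTorus (Fin n)

/-- Normalized Haar measure on `𝕋ⁿ`. -/
def haarT (n : ℕ) : Measure (Tn n) := Measure.pi fun _ => AddCircle.haarAddCircle

/-- Counting measure times normalized Haar measure on `ℤⁿ × 𝕋ⁿ`. -/
def haarZT (n : ℕ) : Measure (Zn n × Tn n) := Measure.count.prod (haarT n)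

/-- Haar measure on the phase space of `ℤⁿ × 𝕋ⁿ`, i.e. on `(ℤⁿ × 𝕋ⁿ) × (𝕋ⁿ × ℤⁿ)`, where
`𝕋ⁿ × ℤⁿ` is the dual group of `ℤⁿ × 𝕋ⁿ`. -/
def haarPhase (n : ℕ) : Measure ((Zn n × Tn n) × (Tn n × Zn n)) :=
  (haarZT n).prod ((haarT n).prod Measure.count)

/-- The character `e^{2πi w·k}`, for `k ∈ ℤⁿ` and `w ∈ 𝕋ⁿ`. -/
def chr {n : ℕ} (k : Zn n) (w : Tn n) : ℂ := UnitAddTorus.mFourier k w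

/-! ### Modulation spaces on `ℤⁿ` -/

/-- The Schwartz space `𝓢(ℤⁿ)`: rapidly decreasing sequences. -/
def IsSchwartzZ {n : ℕ} (g : Zn n → ℂ) : Prop :=
  ∀ M : ℕ, ∃ C : ℝ, ∀ k, (1 + ‖k‖) ^ M * ‖g k‖ ≤ C

/-- The tempered distributions on `ℤⁿ`, identified in the usual way with the sequences of at most
polynomial growth: `f` acts on `𝓢(ℤⁿ)` by `φ ↦ ∑ₖ f(k) φ(k)`. -/
def IsTemperedZ {n : ℕ} (f : Zn n → ℂ) : Prop :=
  ∃ (M : ℕ) (C : ℝ), ∀ k, ‖f k‖ ≤ C * (1 + ‖k‖) ^ M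

/-- The time-frequency shift `M_w T_m g` on `ℤⁿ`. -/
def shiftZ {n : ℕ} (m : Zn n) (w : Tn n) (g : Zn n → ℂ) : Zn n → ℂ :=
  fun k => chr k w * g (k - m)

/-- The short-time Fourier transform `V_g f (m, w) = ∑ₖ f(k) conj (M_w T_m g (k))` on `ℤⁿ`. -/
def stftZ {n : ℕ} (g f : Zn n → ℂ) (z : Zn n × Tn n) : ℂ :=
  ∑' k, f k * starRingEnd ℂ (shiftZ z.1 z.2 g k)

/-- `f ∈ M^p(ℤⁿ)`, where `φ` is the window used to define the modulation space. -/
def MemModulationZ {n : ℕ} (φ : Zn n → ℂ) (p : ENNReal) (f : Zn n → ℂ) : Prop :=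
  IsTemperedZ f ∧ MemLp (stftZ φ f) p (haarZT n)

/-! ### Schwartz functions and tempered distributions on `ℤⁿ × 𝕋ⁿ` -/

/-- The `ℤⁿ`-periodic function on `ℝⁿ` given by `φ(m, ·)`. -/
def lift {n : ℕ} (φ : Zn n × Tn n → ℂ) (m : Zn n) : (Fin n → ℝ) → ℂ :=
  fun x => φ (m, fun i => (x i : UnitAddCircle))

/-- The Schwartz space `𝓢(ℤⁿ × 𝕋ⁿ)`: the functions that are smooth on `𝕋ⁿ` and all of whose
derivatives in the torus variable decrease rapidly in `m ∈ ℤⁿ`, uniformly on `𝕋ⁿ`. -/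
def SchwartzZT (n : ℕ) : Submodule ℂ (Zn n × Tn n → ℂ) where
  carrier := {φ | (∀ m, ContDiff ℝ ∞ (lift φ m)) ∧
    ∀ M j : ℕ, ∃ C : ℝ, ∀ m x, (1 + ‖m‖) ^ M * ‖iteratedFDeriv ℝ j (lift φ m) x‖ ≤ C}
  zero_mem' := by
    have h0 : ∀ m : Zn n, lift (0 : Zn n × Tn n → ℂ) m = fun _ => 0 := fun m => rfl
    refine ⟨fun m => ?_, fun M j => ⟨0, fun m x => ?_⟩⟩
    · rw [h0]; exact contDiff_const
    · rw [h0]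
      have : iteratedFDeriv ℝ j (fun _ : Fin n → ℝ => (0 : ℂ)) = 0 := iteratedFDeriv_fun_zero
      simp [this]
  add_mem' := by
    rintro φ ψ ⟨hφ, hφ'⟩ ⟨hψ, hψ'⟩
    have h0 : ∀ m : Zn n, lift (φ + ψ) m = lift φ m + lift ψ m := fun m => rfl
    refine ⟨fun m => ?_, fun M j => ?_⟩
    · rw [h0]; exact (hφ m).add (hψ m)
    · obtain ⟨C, hC⟩ := hφ' M j
      obtain ⟨D, hD⟩ := hψ' M j
      refine ⟨C + D, fun m x => ?_⟩
      have hj : ((j : ℕ∞) : WithTop ℕ∞) ≤ ∞ := by exact_mod_cast le_top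
      rw [h0, iteratedFDeriv_add_apply ((hφ m).of_le hj).contDiffAt
        ((hψ m).of_le hj).contDiffAt]
      have hp : 0 ≤ (1 + ‖m‖) ^ M := by positivity
      calc _ ≤ (1 + ‖m‖) ^ M * (‖iteratedFDeriv ℝ j (lift φ m) x‖
              + ‖iteratedFDeriv ℝ j (lift ψ m) x‖) :=
            mul_le_mul_of_nonneg_left (norm_add_le _ _) hp
        _ ≤ C + D := by rw [mul_add]; exact add_le_add (hC m x) (hD m x)
  smul_mem' := by
    rintro c φ ⟨hφ, hφ'⟩
    have h0 : ∀ m : Zn n, lift (c • φ) m = c • lift φ m := fun m => rfl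
    refine ⟨fun m => ?_, fun M j => ?_⟩
    · rw [h0]; exact (hφ m).const_smul c
    · obtain ⟨C, hC⟩ := hφ' M j
      refine ⟨‖c‖ * C, fun m x => ?_⟩
      have hj : ((j : ℕ∞) : WithTop ℕ∞) ≤ ∞ := by exact_mod_cast le_top
      rw [h0, iteratedFDeriv_const_smul_apply ((hφ m).of_le hj).contDiffAt, norm_smul]
      calc _ = ‖c‖ * ((1 + ‖m‖) ^ M * ‖iteratedFDeriv ℝ j (lift φ m) x‖) := by ring
        _ ≤ ‖c‖ * C := mul_le_mul_of_nonneg_left (hC m x) (norm_nonneg c)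

/-- Complex conjugation on `𝓢(ℤⁿ × 𝕋ⁿ)`. -/
def conjZT {n : ℕ} (φ : SchwartzZT n) : SchwartzZT n :=
  ⟨fun z => starRingEnd ℂ (φ.1 z), by
    obtain ⟨φ, hφ, hφ'⟩ := φ
    have h0 : ∀ m : Zn n, lift (fun z => starRingEnd ℂ (φ z)) m
        = Complex.conjLIE ∘ lift φ m := fun m => rfl
    refine ⟨fun m => ?_, fun M j => ?_⟩
    · rw [h0]; exact Complex.conjLIE.contDiff.comp (hφ m)
    · obtain ⟨C, hC⟩ := hφ' M j
      refine ⟨C, fun m x => ?_⟩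
      rw [h0, LinearIsometryEquiv.norm_iteratedFDeriv_comp_left]
      exact hC m x⟩

theorem norm_chr {n : ℕ} (k : Zn n) (w : Tn n) : ‖chr k w‖ = 1 := by
  simp only [chr, UnitAddTorus.mFourier, ContinuousMap.coe_mk, norm_prod, fourier_apply,
    Circle.norm_coe, Finset.prod_const_one]

theorem chr_add {n : ℕ} (k : Zn n) (v w : Tn n) : chr k (v + w) = chr k v * chr k w := by
  simp only [chr, UnitAddTorus.mFourier, ContinuousMap.coe_mk, fourier_apply, Pi.add_apply,
    smul_add, AddCircle.toCircle_add, Circle.coe_mul, Finset.prod_mul_distrib]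

/-- A character of `𝕋ⁿ`, seen as a periodic function on `ℝⁿ`, is smooth. -/
theorem contDiff_chr {n : ℕ} (l : Zn n) :
    ContDiff ℝ ∞ (fun x : Fin n → ℝ => chr l fun i => (x i : UnitAddCircle)) := by
  have h : (fun x : Fin n → ℝ => chr l fun i => (x i : UnitAddCircle)) =
      fun x => ∏ i, Complex.exp (2 * Real.pi * Complex.I * l i * x i) := by
    funext x
    simp [chr, UnitAddTorus.mFourier]
  rw [h]
  refine contDiff_prod fun i _ => ?_
  refine ContDiff.cexp (contDiff_const.mul ?_)
  exact Complex.ofRealCLM.contDiff.comp (contDiff_apply ℝ ℝ i)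

/-- The derivatives of a character are bounded. -/
theorem norm_iteratedFDeriv_chr {n : ℕ} (l : Zn n) (j : ℕ) (x : Fin n → ℝ) :
    ‖iteratedFDeriv ℝ j (fun x : Fin n → ℝ => chr l fun i => (x i : UnitAddCircle)) x‖ =
      ‖iteratedFDeriv ℝ j (fun x : Fin n → ℝ => chr l fun i => (x i : UnitAddCircle)) 0‖ := by
  set E : (Fin n → ℝ) → ℂ := fun x => chr l fun i => (x i : UnitAddCircle) with hE
  have hadd : (fun y => E (y + x)) = E x • E := by
    funext y
    rw [Pi.smul_apply, smul_eq_mul, mul_comm]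
    exact chr_add l (fun i => (y i : UnitAddCircle)) (fun i => (x i : UnitAddCircle))
  have hnorm : ‖E x‖ = 1 := norm_chr l _
  have h1 := iteratedFDeriv_comp_add_right (𝕜 := ℝ) (f := E) j x 0
  have hj : ((j : ℕ∞) : WithTop ℕ∞) ≤ ∞ := by exact_mod_cast le_top
  rw [hadd, iteratedFDeriv_const_smul_apply ((contDiff_chr l).of_le hj).contDiffAt,
    zero_add] at h1
  rw [← h1, norm_smul, hnorm, one_mul]

/-- The translate `T_{(m, w)} φ (k, v) = φ(k - m, v - w)` on `𝓢(ℤⁿ × 𝕋ⁿ)`. -/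
def translateZT {n : ℕ} (z : Zn n × Tn n) (φ : SchwartzZT n) : SchwartzZT n :=
  ⟨fun y => φ.1 (y - z), by
    obtain ⟨φ, hφ, hφ'⟩ := φ
    obtain ⟨m, w⟩ := z
    have hr : ∀ i, ∃ r : ℝ, (r : UnitAddCircle) = w i := fun i =>
      QuotientAddGroup.mk_surjective (w i)
    choose r hr using hr
    have h0 : ∀ k : Zn n, lift (fun y => φ (y - (m, w))) k
        = fun x => lift φ (k - m) (x - r) := by
      intro k
      funext x
      simp only [lift, Prod.mk_sub_mk]
      congr 2
      funext i
      simp [hr]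
    refine ⟨fun k => ?_, fun M j => ?_⟩
    · rw [h0]; exact (hφ (k - m)).comp (contDiff_id.sub contDiff_const)
    · obtain ⟨C, hC⟩ := hφ' M j
      refine ⟨(1 + ‖m‖) ^ M * C, fun k x => ?_⟩
      rw [h0, iteratedFDeriv_comp_sub]
      have hk : 1 + ‖k‖ ≤ (1 + ‖m‖) * (1 + ‖k - m‖) := by
        have : ‖k‖ ≤ ‖k - m‖ + ‖m‖ := by simpa using norm_add_le (k - m) m
        nlinarith [norm_nonneg m, norm_nonneg (k - m)]
      calc _ ≤ ((1 + ‖m‖) * (1 + ‖k - m‖)) ^ M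
                * ‖iteratedFDeriv ℝ j (lift φ (k - m)) (x - r)‖ := by gcongr
        _ = (1 + ‖m‖) ^ M * ((1 + ‖k - m‖) ^ M
                * ‖iteratedFDeriv ℝ j (lift φ (k - m)) (x - r)‖) := by rw [mul_pow, mul_assoc]
        _ ≤ (1 + ‖m‖) ^ M * C := mul_le_mul_of_nonneg_left (hC _ _) (by positivity)⟩

/-- The modulation `M_{(x, l)} φ (k, v) = e^{2πi (x·k + l·v)} φ(k, v)` on `𝓢(ℤⁿ × 𝕋ⁿ)`. -/
def modulateZT {n : ℕ} (ζ : Tn n × Zn n) (φ : SchwartzZT n) : SchwartzZT n :=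
  ⟨fun y => chr y.1 ζ.1 * chr ζ.2 y.2 * φ.1 y, by
    obtain ⟨φ, hφ, hφ'⟩ := φ
    obtain ⟨a, l⟩ := ζ
    have h0 : ∀ k : Zn n, lift (fun y => chr y.1 a * chr l y.2 * φ y) k
        = chr k a • fun x => (chr l fun i => (x i : UnitAddCircle)) * lift φ k x := by
      intro k
      funext x
      simp [lift, mul_assoc]
    have hs : ∀ k : Zn n, ContDiff ℝ ∞
        (fun x => (chr l fun i => (x i : UnitAddCircle)) * lift φ k x) := fun k =>
      (contDiff_chr l).mul (hφ k)
    refine ⟨fun k => ?_, fun M j => ?_⟩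
    · rw [h0]; exact (hs k).const_smul (chr k a)
    · choose C hC using hφ' M
      set D : ℕ → ℝ := fun i => ‖iteratedFDeriv ℝ i
        (fun x : Fin n → ℝ => chr l fun i => (x i : UnitAddCircle)) 0‖ with hD
      refine ⟨∑ i ∈ Finset.range (j + 1), (j.choose i : ℝ) * D i * C (j - i), fun k x => ?_⟩
      have hj : ((j : ℕ∞) : WithTop ℕ∞) ≤ ∞ := by exact_mod_cast le_top
      have hn : ‖chr k a‖ = 1 := norm_chr k a
      simp only [h0]
      rw [iteratedFDeriv_const_smul_apply ((hs k).of_le hj).contDiffAt, norm_smul, hn, one_mul]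
      calc _ ≤ (1 + ‖k‖) ^ M * ∑ i ∈ Finset.range (j + 1), (j.choose i : ℝ)
              * ‖iteratedFDeriv ℝ i
                  (fun x : Fin n → ℝ => chr l fun i => (x i : UnitAddCircle)) x‖
              * ‖iteratedFDeriv ℝ (j - i) (lift φ k) x‖ :=
            mul_le_mul_of_nonneg_left
              (norm_iteratedFDeriv_mul_le (contDiff_chr l) (hφ k) x hj) (by positivity)
        _ = ∑ i ∈ Finset.range (j + 1), (j.choose i : ℝ) * D i
              * ((1 + ‖k‖) ^ M * ‖iteratedFDeriv ℝ (j - i) (lift φ k) x‖) := by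
            rw [Finset.mul_sum]
            refine Finset.sum_congr rfl fun i _ => ?_
            rw [norm_iteratedFDeriv_chr]
            ring
        _ ≤ _ := by
            refine Finset.sum_le_sum fun i _ => mul_le_mul_of_nonneg_left (hC _ _ _) ?_
            positivity⟩

/-- Continuity of a linear functional on `𝓢(ℤⁿ × 𝕋ⁿ)`, i.e. `σ ∈ 𝓢'(ℤⁿ × 𝕋ⁿ)`: the functional is
bounded by a constant times the maximum of finitely many of the seminorms
`sup_{m, x} (1 + |m|)^M |∂ʲφ(m, x)|`. -/
def IsTemperedZT {n : ℕ} (σ : SchwartzZT n →ₗ[ℂ] ℂ) : Prop :=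
  ∃ (N : ℕ) (C : ℝ), ∀ (φ : SchwartzZT n) (b : ℝ),
    (∀ M ≤ N, ∀ j ≤ N, ∀ m x, (1 + ‖m‖) ^ M * ‖iteratedFDeriv ℝ j (lift φ.1 m) x‖ ≤ b) →
      ‖σ φ‖ ≤ C * b

/-! ### Modulation spaces on `ℤⁿ × 𝕋ⁿ` -/

/-- The short-time Fourier transform `V_Φ σ (z, ζ) = ⟨σ, M_ζ T_z Φ⟩` of a distribution on
`ℤⁿ × 𝕋ⁿ`, where `⟨σ, ψ⟩ = σ(conj ψ)`, `z ∈ ℤⁿ × 𝕋ⁿ` and `ζ ∈ 𝕋ⁿ × ℤⁿ`. -/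
def stftZT {n : ℕ} (Φ : SchwartzZT n) (σ : SchwartzZT n →ₗ[ℂ] ℂ)
    (q : (Zn n × Tn n) × (Tn n × Zn n)) : ℂ :=
  σ (conjZT (modulateZT q.2 (translateZT q.1 Φ)))

/-- `σ ∈ M^p(ℤⁿ × 𝕋ⁿ)`, where `Φ` is the window used to define the modulation space. -/
def MemModulationZT {n : ℕ} (Φ : SchwartzZT n) (p : ENNReal) (σ : SchwartzZT n →ₗ[ℂ] ℂ) : Prop :=
  IsTemperedZT σ ∧ MemLp (stftZT Φ σ) p (haarPhase n)

/-- The norm of `M^p(ℤⁿ × 𝕋ⁿ)`. -/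
def modulationNormZT {n : ℕ} (Φ : SchwartzZT n) (p : ENNReal) (σ : SchwartzZT n →ₗ[ℂ] ℂ) : ENNReal :=
  eLpNorm (stftZT Φ σ) p (haarPhase n)

/-- The distribution `τ` is the integrable function `u`. -/
def IsRegular {n : ℕ} (τ : SchwartzZT n →ₗ[ℂ] ℂ) (u : Zn n × Tn n → ℂ) : Prop :=
  Integrable u (haarZT n) ∧ ∀ φ : SchwartzZT n, τ φ = ∫ z, u z * φ.1 z ∂haarZT n

/-! ### Localization operators -/

/-- The Hilbert space `ℓ²(ℤⁿ)`. -/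
abbrev ell2 (n : ℕ) : Type := lp (fun _ : Zn n => ℂ) 2

/-- `A` is the localization operator whose symbol is the function `u` and whose windows are
`g₁, g₂`: for all `f ∈ ℓ²(ℤⁿ)` and `k ∈ ℤⁿ`,
`A f (k) = ∑ₘ ∫ u(m, w) V_{g₁} f (m, w) M_w T_m g₂ (k) dw`. -/
def IsLocOpFun {n : ℕ} (g₁ g₂ : Zn n → ℂ) (u : Zn n × Tn n → ℂ) (A : ell2 n →L[ℂ] ell2 n) :
    Prop :=
  ∀ (f : ell2 n) (k : Zn n),
    (A f) k = ∑' m, ∫ w, u (m, w) * stftZ g₁ f (m, w) * shiftZ m w g₂ k ∂haarT n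

/-- `(uᵢ)` is a sequence of functions in `M^1 ∩ M^∞` that converges to `σ` in `M^p`. -/
def Approximates {n : ℕ} (Φ : SchwartzZT n) (p : ENNReal) (u : ℕ → Zn n × Tn n → ℂ)
    (σ : SchwartzZT n →ₗ[ℂ] ℂ) : Prop :=
  ∃ τ : ℕ → SchwartzZT n →ₗ[ℂ] ℂ,
    (∀ i, IsRegular (τ i) (u i) ∧ MemModulationZT Φ 1 (τ i) ∧ MemModulationZT Φ ⊤ (τ i)) ∧
    Filter.Tendsto (fun i => modulationNormZT Φ p (τ i - σ)) Filter.atTop (nhds 0)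

/-- `A` is the localization operator with symbol `σ ∈ M^p(ℤⁿ × 𝕋ⁿ)` and windows `g₁, g₂`, defined
by continuous extension from symbols that are functions in `M^1 ∩ M^∞`: there are such functions
that converge to `σ` in `M^p`, and for every such sequence the localization operators are bounded
and converge to `A` in operator norm. -/
def IsLocOp {n : ℕ} (Φ : SchwartzZT n) (p : ENNReal) (g₁ g₂ : Zn n → ℂ)
    (σ : SchwartzZT n →ₗ[ℂ] ℂ) (A : ell2 n →L[ℂ] ell2 n) : Prop :=
  (∃ u, Approximates Φ p u σ) ∧
    ∀ u, Approximates Φ p u σ → ∃ B : ℕ → ell2 n →L[ℂ] ell2 n,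
      (∀ i, IsLocOpFun g₁ g₂ (u i) (B i)) ∧ Filter.Tendsto B Filter.atTop (nhds A)

/-- The sum of the singular values of `A`, i.e. of the nonzero eigenvalues of `|A| = √(A* A)`,
counted with multiplicity. -/
def singularValueSum {H : Type*} [NormedAddCommGroup H] [InnerProductSpace ℂ H] [CompleteSpace H]
    (A : H →L[ℂ] H) : ENNReal :=
  ∑' s : {s : ℝ // 0 < s},
    (Module.finrank ℂ (Module.End.eigenspace ((CFC.abs A : H →L[ℂ] H) : H →ₗ[ℂ] H)
      ((s : ℝ) : ℂ)) : ENNReal) * ENNReal.ofReal s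

/-- The trace class `S₁`: the compact operators whose singular values are summable. -/
def IsTraceClass {H : Type*} [NormedAddCommGroup H] [InnerProductSpace ℂ H] [CompleteSpace H]
    (A : H →L[ℂ] H) : Prop :=
  IsCompactOperator A ∧ singularValueSum A < ⊤

end

end DiscreteLoc

open DiscreteLoc

/-!
Expand `σ` in a Fourier series in the torus variable, with coefficients `c(m, j)`. If `Φ̂` denotes
the coefficients of the window, then `V_Φ σ((m, w), (x, l))` is, up to a unimodular factor, the
Fourier series in `(x, w)` of the absolutely summable family `q ↦ conj (Φ̂ q) c(q + (m, l))`. Hence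
the norm of `σ` in `M^p` is equivalent to the norm of `c` in `ℓ^p`, and for `p < ∞` the
trigonometric polynomials are dense in `M^p`.

Since windows in `M^1(ℤⁿ)` are summable, the localization operator is the absolutely convergent sum
over `(s, t)` of `g₂(s) conj (g₁(t))` times the weighted shift
`f ↦ (k ↦ c(k - s, t - s) f(k - s + t))`. This depends norm-continuously on `c ∈ ℓ^∞`, so on
`σ ∈ M^p`. If `c` is summable, it is an absolutely convergent sum of rank-one operators, hence of
trace class; compactness for `σ ∈ M^p` follows by density.
-/

namespace DiscreteLoc

noncomputable section

/-! ### Nuclear operators are of trace class -/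

section TraceClass

open InnerProductSpace

theorem isCompactOperator_rankOne {𝕜 E F : Type*} [RCLike 𝕜] [NormedAddCommGroup E]
    [InnerProductSpace 𝕜 E] [NormedAddCommGroup F] [InnerProductSpace 𝕜 F] (x : E) (y : F) :
    IsCompactOperator (rankOne 𝕜 x y) := by
  rw [rankOne_def']
  exact (isCompactOperator_of_locallyCompactSpace_rng
    (ContinuousLinearMap.toSpanSingleton 𝕜 x)).comp_clm (innerSL 𝕜 y)

theorem isCompactOperator_of_hasSum {𝕜 E F ι : Type*} [NontriviallyNormedField 𝕜]
    [NormedAddCommGroup E] [NormedSpace 𝕜 E] [NormedAddCommGroup F] [NormedSpace 𝕜 F]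
    [CompleteSpace F] {T : ι → E →L[𝕜] F} {A : E →L[𝕜] F} (hT : ∀ i, IsCompactOperator (T i))
    (hA : HasSum T A) : IsCompactOperator A :=
  isCompactOperator_of_tendsto hA <| .of_forall fun _ =>
    (compactOperator (RingHom.id 𝕜) E F).sum_mem fun i _ => hT i

section RCLike

variable {𝕜 H : Type*} [RCLike 𝕜] [NormedAddCommGroup H] [InnerProductSpace 𝕜 H]

theorem exists_orthonormal_finrank (E : Submodule 𝕜 H) :
    ∃ b : Fin (Module.finrank 𝕜 E) → E, Orthonormal 𝕜 b := by
  obtain h | h := (Module.finrank 𝕜 E).eq_zero_or_pos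
  · rw [h]
    exact ⟨finZeroElim, finZeroElim, fun i => i.elim0⟩
  · have := Module.finite_of_finrank_pos h
    exact ⟨stdOrthonormalBasis 𝕜 E, (stdOrthonormalBasis 𝕜 E).orthonormal⟩

theorem exists_orthonormal_eigenvectors {T : H →ₗ[𝕜] H} (hT : T.IsSymmetric)
    (S : Finset {s : ℝ // 0 < s}) :
    ∃ (α : Type) (_ : Fintype α) (v : α → H) (s : α → ℝ), Orthonormal 𝕜 v ∧
      (∀ a, 0 < s a ∧ T (v a) = (s a : 𝕜) • v a) ∧
      ∑ t ∈ S, (Module.finrank 𝕜 (Module.End.eigenspace T ((t : ℝ) : 𝕜)) : ENNReal) *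
        ENNReal.ofReal t = ENNReal.ofReal (∑ a, s a) := by
  set d : S → ℕ := fun t => Module.finrank 𝕜 (Module.End.eigenspace T ((t.1 : ℝ) : 𝕜)) with hd
  choose b hb using fun t : S =>
    exists_orthonormal_finrank (Module.End.eigenspace T ((t.1 : ℝ) : 𝕜))
  have horth := hT.orthogonalFamily_eigenspaces.comp (f := fun t : S => ((t.1 : ℝ) : 𝕜))
    fun _ _ h => Subtype.ext (Subtype.ext (RCLike.ofReal_injective h))
  refine ⟨Σ t, Fin (d t), inferInstance, fun a => b a.1 a.2, fun a => a.1.1,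
    horth.orthonormal_sigma_orthonormal hb,
    fun a => ⟨a.1.1.2, Module.End.mem_eigenspace_iff.1 (b a.1 a.2).2⟩, ?_⟩
  rw [ENNReal.ofReal_sum_of_nonneg fun a _ => a.1.1.2.le, Fintype.sum_sigma,
    ← Finset.sum_coe_sort S]
  simp [hd]

theorem norm_sum_inner_le_of_hasSum_rankOne {ι α : Type*} [Fintype α] {x y : ι → H}
    {A : H →L[𝕜] H} (hA : HasSum (fun i => rankOne 𝕜 (x i) (y i)) A)
    (hs : Summable fun i => ‖x i‖ * ‖y i‖) {u v : α → H} (hu : Orthonormal 𝕜 u)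
    (hv : Orthonormal 𝕜 v) :
    ‖∑ a, inner 𝕜 (u a) (A (v a))‖ ≤ ∑' i, ‖x i‖ * ‖y i‖ := by
  have hsum : HasSum (fun i => ∑ a, inner 𝕜 (u a) (rankOne 𝕜 (x i) (y i) (v a)))
      (∑ a, inner 𝕜 (u a) (A (v a))) := hasSum_sum fun a _ =>
    hA.mapL ((innerSL 𝕜 (u a)).comp (ContinuousLinearMap.apply 𝕜 H (v a)))
  refine hsum.norm_le_of_bounded hs.hasSum fun i => ?_
  calc ‖∑ a, inner 𝕜 (u a) (rankOne 𝕜 (x i) (y i) (v a))‖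
      ≤ ∑ a, ‖inner 𝕜 (u a) (x i)‖ * ‖inner 𝕜 (v a) (y i)‖ := by
        refine norm_sum_le_of_le _ fun a _ => le_of_eq ?_
        rw [rankOne_apply, inner_smul_right, norm_mul, mul_comm, norm_inner_symm (y i)]
    _ ≤ √(∑ a, ‖inner 𝕜 (u a) (x i)‖ ^ 2) * √(∑ a, ‖inner 𝕜 (v a) (y i)‖ ^ 2) :=
        Real.sum_mul_le_sqrt_mul_sqrt _ _ _
    _ ≤ ‖x i‖ * ‖y i‖ := by
        gcongr
        · exact (Real.sqrt_le_left (norm_nonneg _)).2 (hu.sum_inner_products_le _)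
        · exact (Real.sqrt_le_left (norm_nonneg _)).2 (hv.sum_inner_products_le _)

end RCLike

variable {H : Type*} [NormedAddCommGroup H] [InnerProductSpace ℂ H] [CompleteSpace H]

theorem inner_abs_apply_abs_apply (A : H →L[ℂ] H) (v w : H) :
    inner ℂ (CFC.abs A v) (CFC.abs A w) = inner ℂ (A v) (A w) := by
  have hsq : CFC.abs A (CFC.abs A w) = ContinuousLinearMap.adjoint A (A w) :=
    DFunLike.congr_fun (CFC.abs_mul_abs A) w
  have hself : ContinuousLinearMap.adjoint (CFC.abs A) = CFC.abs A :=
    (CFC.abs_nonneg A).isSelfAdjoint.adjoint_eq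
  rw [← ContinuousLinearMap.adjoint_inner_right, hself, hsq,
    ContinuousLinearMap.adjoint_inner_right]

variable {ι : Type*} {x y : ι → H} {A : H →L[ℂ] H}

theorem sum_le_of_hasSum_rankOne_of_abs_eigenvectors
    (hA : HasSum (fun i => rankOne ℂ (x i) (y i)) A) (hs : Summable fun i => ‖x i‖ * ‖y i‖)
    {α : Type*} [Fintype α] {v : α → H} (hv : Orthonormal ℂ v) {s : α → ℝ}
    (h : ∀ a, 0 < s a ∧ CFC.abs A (v a) = (s a : ℂ) • v a) :
    ∑ a, s a ≤ ∑' i, ‖x i‖ * ‖y i‖ := by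
  classical
  have hne (a) : (s a : ℂ) ≠ 0 := mod_cast (h a).1.ne'
  have hinner (a b) : inner ℂ ((s a : ℂ)⁻¹ • A (v a)) (A (v b)) =
      if a = b then (s b : ℂ) else 0 := by
    rw [inner_smul_left, ← inner_abs_apply_abs_apply, (h a).2, (h b).2, inner_smul_left,
      inner_smul_right, orthonormal_iff_ite.1 hv, map_inv₀, Complex.conj_ofReal,
      inv_mul_cancel_left₀ (hne a), mul_ite, mul_one, mul_zero]
  have hu : Orthonormal ℂ fun a => (s a : ℂ)⁻¹ • A (v a) := by
    refine orthonormal_iff_ite.2 fun a b => ?_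
    rw [inner_smul_right, hinner, mul_ite, inv_mul_cancel₀ (hne b), mul_zero]
  have hsum : ∑ a, inner ℂ ((s a : ℂ)⁻¹ • A (v a)) (A (v a)) = ((∑ a, s a : ℝ) : ℂ) := by
    simp only [hinner, if_true, Complex.ofReal_sum]
  have hle := norm_sum_inner_le_of_hasSum_rankOne hA hs hu hv
  rw [hsum, Complex.norm_real] at hle
  exact (Real.le_norm_self _).trans hle

theorem isTraceClass_of_hasSum_rankOne (hA : HasSum (fun i => rankOne ℂ (x i) (y i)) A)
    (hs : Summable fun i => ‖x i‖ * ‖y i‖) : IsTraceClass A := by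
  refine ⟨isCompactOperator_of_hasSum (fun i => isCompactOperator_rankOne _ _) hA,
    lt_of_le_of_lt ?_ (ENNReal.ofReal_lt_top (r := ∑' i, ‖x i‖ * ‖y i‖))⟩
  rw [singularValueSum, ENNReal.tsum_eq_iSup_sum]
  refine iSup_le fun S => ?_
  have hsymm := ContinuousLinearMap.isSelfAdjoint_iff_isSymmetric.1
    (CFC.abs_nonneg A).isSelfAdjoint
  obtain ⟨α, _, v, s, hv, h, hsum⟩ := exists_orthonormal_eigenvectors hsymm S
  exact hsum.trans_le <| ENNReal.ofReal_le_ofReal <|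
    sum_le_of_hasSum_rankOne_of_abs_eigenvectors hA hs hv h

end TraceClass

/-! ### Absolutely convergent expansions in orthogonal families -/

section Expansion

theorem hasSum_integral_mul_of_summable {𝕜 α ι : Type*} [RCLike 𝕜] [Countable ι]
    [MeasurableSpace α] {μ : Measure α} {v : α → 𝕜} (hv : Integrable v μ) {χ : ι → α → 𝕜}
    (hχ : ∀ i, AEStronglyMeasurable (χ i) μ) (hχ_le : ∀ i x, ‖χ i x‖ ≤ 1) {b : ι → 𝕜}
    (hb : Summable fun i => ‖b i‖) :
    HasSum (fun i => b i * ∫ x, v x * χ i x ∂μ) (∫ x, v x * ∑' i, b i * χ i x ∂μ) := by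
  have hint (i) : Integrable (fun x => v x * χ i x) μ :=
    hv.mul_bdd (hχ i) (.of_forall (hχ_le i))
  have hnorm (i) : ∫ x, ‖b i * (v x * χ i x)‖ ∂μ ≤ ‖b i‖ * ∫ x, ‖v x‖ ∂μ := by
    rw [← integral_const_mul]
    refine integral_mono ((hint i).const_mul _).norm (hv.norm.const_mul _) fun x => ?_
    simp only [norm_mul]
    gcongr
    exact mul_le_of_le_one_right (norm_nonneg _) (hχ_le i x)
  have h := hasSum_integral_of_summable_integral_norm (fun i => (hint i).const_mul (b i))
    (.of_nonneg_of_le (fun _ => integral_nonneg fun _ => norm_nonneg _) hnorm (hb.mul_right _))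
  simp only [← tsum_mul_left, mul_left_comm (v _) (b _)]
  simpa only [integral_const_mul] using h

theorem enorm_coeff_le_lintegral_of_hasSum {𝕜 α ι : Type*} [RCLike 𝕜] [Countable ι]
    [MeasurableSpace α] {μ : Measure α} [IsFiniteMeasure μ] {χ : ι → α → 𝕜}
    (hχ : ∀ i, AEStronglyMeasurable (χ i) μ) (hχ_le : ∀ i x, ‖χ i x‖ ≤ 1) {r : ι}
    (hr : ∫ x, starRingEnd 𝕜 (χ r x) * χ r x ∂μ = 1)
    (hne : ∀ i ≠ r, ∫ x, starRingEnd 𝕜 (χ r x) * χ i x ∂μ = 0) {b : ι → 𝕜}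
    (hb : Summable fun i => ‖b i‖) {F : α → 𝕜} (hF : ∀ x, HasSum (fun i => b i * χ i x) (F x)) :
    ‖b r‖ₑ ≤ ∫⁻ x, ‖F x‖ₑ ∂μ := by
  have hv : Integrable (fun x => starRingEnd 𝕜 (χ r x)) μ :=
    .of_bound (RCLike.continuous_conj.comp_aestronglyMeasurable (hχ r)) 1 <| .of_forall fun x => by
      rw [RCLike.norm_conj]
      exact hχ_le r x
  have hsum := hasSum_integral_mul_of_summable hv hχ hχ_le hb
  simp only [(hF _).tsum_eq] at hsum
  have hcoeff : b r = ∫ x, starRingEnd 𝕜 (χ r x) * F x ∂μ := by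
    rw [hsum.unique (hasSum_single r fun i hi => by rw [hne i hi, mul_zero]), hr, mul_one]
  rw [hcoeff]
  refine (enorm_integral_le_lintegral_enorm _).trans (lintegral_mono fun x => ?_)
  rw [enorm_mul, RCLike.enorm_conj]
  refine mul_le_of_le_one_left zero_le ?_
  simpa only [enorm_one] using
    enorm_le_iff_norm_le.2 ((hχ_le r x).trans_eq (norm_one (α := 𝕜)).symm)

theorem eLpNorm_le_tsum_of_hasSum {α ι E : Type*} [Countable ι] [MeasurableSpace α]
    [NormedAddCommGroup E] {μ : Measure α} {p : ENNReal} (hp : 1 ≤ p) {F : ι → α → E} {f : α → E}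
    (hF : ∀ i, AEStronglyMeasurable (F i) μ) (hf : ∀ x, HasSum (fun i => F i x) (f x)) :
    eLpNorm f p μ ≤ ∑' i, eLpNorm (F i) p μ := by
  obtain ⟨s, hs⟩ := Filter.exists_seq_tendsto (Filter.atTop : Filter (Finset ι))
  refine (Lp.eLpNorm_lim_le_liminf_eLpNorm (f := fun N => ∑ i ∈ s N, F i)
    (fun N => Finset.aestronglyMeasurable_sum _ fun i _ => hF i) f
    (.of_forall fun x => ?_)).trans ?_
  · simpa only [Finset.sum_apply, Function.comp_def] using (hf x).comp hs
  · exact Filter.liminf_le_of_frequently_le' <| .of_forall fun N =>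
      (eLpNorm_sum_le (fun i _ => hF i) hp).trans (ENNReal.sum_le_tsum _)

end Expansion

/-! ### Characters of the torus -/

section Characters

variable {n : ℕ}

theorem continuous_chr (k : Zn n) : Continuous (chr k : Tn n → ℂ) :=
  (UnitAddTorus.mFourier k).continuous

theorem chr_neg (k : Zn n) (w : Tn n) : chr (-k) w = starRingEnd ℂ (chr k w) :=
  UnitAddTorus.mFourier_neg

theorem chr_add_left (k l : Zn n) (w : Tn n) : chr (k + l) w = chr k w * chr l w :=
  UnitAddTorus.mFourier_add

theorem chr_zero (w : Tn n) : chr 0 w = 1 := by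
  rw [chr, UnitAddTorus.mFourier_zero, ContinuousMap.one_apply]

theorem conj_chr_mul_chr (k l : Zn n) (w : Tn n) :
    starRingEnd ℂ (chr k w) * chr l w = chr (l - k) w := by
  rw [← chr_neg, ← chr_add_left, neg_add_eq_sub]

/-- The projection `ℝⁿ → 𝕋ⁿ`. -/
def toTorus (x : Fin n → ℝ) : Tn n := fun i => (x i : UnitAddCircle)

theorem isOpenQuotientMap_toTorus : IsOpenQuotientMap (toTorus : (Fin n → ℝ) → Tn n) :=
  .piMap fun _ => QuotientAddGroup.isOpenQuotientMap_mk

theorem toTorus_sub (x y : Fin n → ℝ) : toTorus (x - y) = toTorus x - toTorus y :=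
  funext fun i => AddCircle.coe_sub 1 (x i) (y i)

theorem chr_toTorus (l : Zn n) (x : Fin n → ℝ) :
    chr l (toTorus x) = Complex.exp (2 * Real.pi * Complex.I * ∑ i, (l i : ℝ) * x i) := by
  simp only [chr, UnitAddTorus.mFourier, toTorus, ContinuousMap.coe_mk, fourier_coe_apply,
    ← Complex.exp_sum]
  push_cast
  rw [Finset.mul_sum]
  simp only [div_one, mul_assoc]

theorem exists_norm_eq_chr_eq_neg_one {j : Zn n} (hj : j ≠ 0) :
    ∃ h : Fin n → ℝ, ‖h‖ = (2 * ‖j‖)⁻¹ ∧ chr j (toTorus h) = -1 := by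
  have : Nonempty (Fin n) := (Function.ne_iff.1 hj).nonempty
  obtain ⟨i, hi : ‖j i‖ = ‖j‖⟩ := (IsGreatest.pi_norm j).1
  have hji : (j i : ℂ) ≠ 0 := by
    rw [Int.cast_ne_zero, ← norm_ne_zero_iff, hi]
    exact norm_ne_zero_iff.2 hj
  refine ⟨Pi.single i (2 * (j i : ℝ))⁻¹, ?_, ?_⟩
  · rw [Pi.norm_single, ← hi, norm_inv, norm_mul, Real.norm_two, Int.norm_eq_abs, Real.norm_eq_abs]
  · rw [chr_toTorus, Finset.sum_eq_single i (fun l _ hl => by simp [hl]) (by simp),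
      ← Complex.exp_pi_mul_I, Pi.single_eq_same]
    push_cast
    congr 1
    field_simp

instance : IsProbabilityMeasure (haarT n) :=
  inferInstanceAs (IsProbabilityMeasure (Measure.pi fun _ => AddCircle.haarAddCircle))

instance : (haarT n).IsAddHaarMeasure :=
  inferInstanceAs (Measure.pi fun _ => AddCircle.haarAddCircle).IsAddHaarMeasure

instance : SFinite (haarZT n) :=
  inferInstanceAs (SFinite (Measure.count.prod (haarT n)))

theorem integral_chr (j : Zn n) : ∫ w, chr j w ∂haarT n = if j = 0 then 1 else 0 := by
  split_ifs with hj
  · simp only [hj, chr_zero, integral_const, probReal_univ, one_smul]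
  · obtain ⟨h, -, hh⟩ := exists_norm_eq_chr_eq_neg_one hj
    refine integral_eq_zero_of_add_right_eq_neg (g := toTorus h) fun w => ?_
    rw [chr_add, hh, mul_neg_one]

end Characters

/-! ### The localization operator as a series of weighted shifts -/

section Precomposition

variable {𝕜 E ι κ : Type*} [NontriviallyNormedField 𝕜] [NormedAddCommGroup E] [NormedSpace 𝕜 E]
  {p : ENNReal} [Fact (1 ≤ p)]

theorem memℓp_comp_embedding (e : κ ↪ ι) (f : lp (fun _ : ι => E) p) :
    Memℓp (fun k => f (e k)) p := by
  obtain rfl | hp := p.dichotomy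
  · exact memℓp_infty (f.2.bddAbove.mono (Set.range_comp_subset_range e fun i => ‖f i‖))
  · exact memℓp_gen ((f.2.summable (zero_lt_one.trans_le hp)).comp_injective e.injective)

theorem norm_comp_embedding_le (e : κ ↪ ι) (f : lp (fun _ : ι => E) p) :
    ‖(⟨fun k => f (e k), memℓp_comp_embedding e f⟩ : lp (fun _ : κ => E) p)‖ ≤ ‖f‖ := by
  obtain rfl | hp := p.dichotomy
  · exact lp.norm_le_of_forall_le (norm_nonneg f) fun k =>
      lp.norm_apply_le_norm ENNReal.top_ne_zero f (e k)
  · have hf := lp.hasSum_norm (zero_lt_one.trans_le hp) f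
    refine lp.norm_le_of_tsum_le (zero_lt_one.trans_le hp) (norm_nonneg f) ?_
    rw [← hf.tsum_eq]
    exact tsum_comp_le_tsum_of_inj hf.summable
      (fun _ => Real.rpow_nonneg (norm_nonneg _) _) e.injective

variable (𝕜 p) in
/-- Precomposition `f ↦ f ∘ e` with an embedding `e` of index sets, as a bounded operator between
`ℓᵖ` spaces. -/
def precompLp (e : κ ↪ ι) : lp (fun _ : ι => E) p →L[𝕜] lp (fun _ : κ => E) p :=
  LinearMap.mkContinuous
    { toFun f := ⟨fun k => f (e k), memℓp_comp_embedding e f⟩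
      map_add' _ _ := rfl
      map_smul' _ _ := rfl } 1 fun f => by
    rw [one_mul]
    exact norm_comp_embedding_le e f

theorem norm_precompLp_le (e : κ ↪ ι) : ‖precompLp (E := E) 𝕜 p e‖ ≤ 1 :=
  LinearMap.mkContinuous_norm_le _ zero_le_one _

end Precomposition

section Operators

variable {n : ℕ}

/-- The space `ℓ^∞(ℤⁿ × ℤⁿ)` of bounded families of Fourier coefficients. -/
abbrev BddCoeff (n : ℕ) : Type := lp (fun _ : Zn n × Zn n => ℂ) ⊤

/-- The weighted shift `f ↦ (k ↦ c(k - s, t - s) f(k - s + t))` on `ℓ²(ℤⁿ)`, as a function of the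
weights `c`. -/
def weightedShift (s t : Zn n) : BddCoeff n →L[ℂ] ell2 n →L[ℂ] ell2 n :=
  (lp.holderL 2 (fun _ => ContinuousLinearMap.mul ℂ ℂ) (K := 1) fun _ =>
      ContinuousLinearMap.opNorm_mul_le ℂ ℂ).bilinearComp
    (precompLp ℂ ⊤ ⟨fun k => (k - s, t - s), fun _ _ h => sub_left_injective (Prod.ext_iff.1 h).1⟩)
    (precompLp ℂ 2 ((Equiv.subRight s).trans (Equiv.addRight t)).toEmbedding)

theorem weightedShift_apply_apply (s t : Zn n) (c : BddCoeff n) (f : ell2 n) (k : Zn n) :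
    weightedShift s t c f k = c (k - s, t - s) * f (k - s + t) :=
  rfl

theorem norm_weightedShift_apply_le (s t : Zn n) (c : BddCoeff n) :
    ‖weightedShift s t c‖ ≤ ‖c‖ := by
  refine ContinuousLinearMap.opNorm_le_bound _ (norm_nonneg c) fun f => ?_
  have hB := ContinuousLinearMap.le_of_opNorm₂_le_of_le _
    (lp.norm_holderL_le (p := ⊤) (q := 2) 2 (fun _ : Zn n => ContinuousLinearMap.mul ℂ ℂ) (K := 1)
      fun _ => ContinuousLinearMap.opNorm_mul_le ℂ ℂ)
    (ContinuousLinearMap.le_of_opNorm_le _ (norm_precompLp_le (𝕜 := ℂ) (p := ⊤)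
      ⟨fun k : Zn n => (k - s, t - s), fun _ _ h => sub_left_injective (Prod.ext_iff.1 h).1⟩) c)
    (ContinuousLinearMap.le_of_opNorm_le _ (norm_precompLp_le (𝕜 := ℂ) (p := 2)
      ((Equiv.subRight s).trans (Equiv.addRight t)).toEmbedding) f)
  simpa only [NNReal.coe_one, one_mul] using! hB

/-- The localization operator with windows `g₁, g₂` and symbol with Fourier coefficients `c`. -/
def coeffLocOp (g₁ g₂ : Zn n → ℂ) (c : BddCoeff n) : ell2 n →L[ℂ] ell2 n :=
  ∑' q : Zn n × Zn n, (g₂ q.1 * starRingEnd ℂ (g₁ q.2)) • weightedShift q.1 q.2 c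

theorem norm_smul_weightedShift_le (g₁ g₂ : Zn n → ℂ) (q : Zn n × Zn n) (c : BddCoeff n) :
    ‖(g₂ q.1 * starRingEnd ℂ (g₁ q.2)) • weightedShift q.1 q.2 c‖ ≤
      ‖g₂ q.1 * starRingEnd ℂ (g₁ q.2)‖ * ‖c‖ :=
  (norm_smul_le _ _).trans
    (mul_le_mul_of_nonneg_left (norm_weightedShift_apply_le q.1 q.2 c) (norm_nonneg _))

variable {g₁ g₂ : Zn n → ℂ} (h₁ : Summable fun k => ‖g₁ k‖) (h₂ : Summable fun k => ‖g₂ k‖)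

include h₁ h₂

theorem summable_norm_window_mul_window :
    Summable fun q : Zn n × Zn n => ‖g₂ q.1 * starRingEnd ℂ (g₁ q.2)‖ := by
  simpa only [norm_mul, RCLike.norm_conj] using
    h₂.mul_of_nonneg h₁ (fun _ => norm_nonneg _) (fun _ => norm_nonneg _)

theorem hasSum_coeffLocOp (c : BddCoeff n) :
    HasSum (fun q : Zn n × Zn n => (g₂ q.1 * starRingEnd ℂ (g₁ q.2)) • weightedShift q.1 q.2 c)
      (coeffLocOp g₁ g₂ c) :=
  (Summable.of_norm_bounded ((summable_norm_window_mul_window h₁ h₂).mul_right ‖c‖)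
    fun q => norm_smul_weightedShift_le g₁ g₂ q c).hasSum

theorem norm_coeffLocOp_sub_le (c d : BddCoeff n) :
    ‖coeffLocOp g₁ g₂ c - coeffLocOp g₁ g₂ d‖ ≤
      (∑' q : Zn n × Zn n, ‖g₂ q.1 * starRingEnd ℂ (g₁ q.2)‖) * ‖c - d‖ := by
  have hsub := (hasSum_coeffLocOp h₁ h₂ c).sub (hasSum_coeffLocOp h₁ h₂ d)
  simp only [← smul_sub, ← map_sub] at hsub
  exact hsub.norm_le_of_bounded ((summable_norm_window_mul_window h₁ h₂).hasSum.mul_right _)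
    fun q => norm_smul_weightedShift_le g₁ g₂ q (c - d)

theorem continuous_coeffLocOp : Continuous (coeffLocOp g₁ g₂) :=
  (LipschitzWith.of_dist_le' fun c d => by
    simpa only [dist_eq_norm] using norm_coeffLocOp_sub_le h₁ h₂ c d).continuous

theorem hasSum_coeffLocOp_apply_apply (c : BddCoeff n) (f : ell2 n) (k : Zn n) :
    HasSum (fun q : Zn n × Zn n => (g₂ q.1 * starRingEnd ℂ (g₁ q.2)) *
      (c (k - q.1, q.2 - q.1) * f (k - q.1 + q.2))) (coeffLocOp g₁ g₂ c f k) :=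
  ((hasSum_coeffLocOp h₁ h₂ c).mapL (ContinuousLinearMap.apply ℂ _ f)).mapL
    (lp.evalCLM ℂ (fun _ : Zn n => ℂ) 2 k)

end Operators

section LocOpFun

variable {n : ℕ} {g₁ g₂ : Zn n → ℂ}

theorem integrable_slice {u : Zn n × Tn n → ℂ} (hu : Integrable u (haarZT n)) (m : Zn n) :
    Integrable (fun w => u (m, w)) (haarT n) :=
  Measure.ae_count_iff.1 hu.prod_right_ae m

theorem stftZ_mul_shiftZ (f : Zn n → ℂ) (k m : Zn n) (w : Tn n) :
    stftZ g₁ f (m, w) * shiftZ m w g₂ k =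
      ∑' r, f r * starRingEnd ℂ (g₁ (r - m)) * g₂ (k - m) * chr (k - r) w := by
  rw [stftZ, ← tsum_mul_right]
  refine tsum_congr fun r => ?_
  rw [shiftZ, shiftZ, map_mul, ← conj_chr_mul_chr]
  ring

theorem hasSum_integral_mul_stftZ_mul_shiftZ (h₁ : Summable fun k => ‖g₁ k‖) {v : Tn n → ℂ}
    (hv : Integrable v (haarT n)) (f : ell2 n) (k m : Zn n) :
    HasSum (fun r => f r * starRingEnd ℂ (g₁ (r - m)) * g₂ (k - m) *
        ∫ w, v w * chr (k - r) w ∂haarT n)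
      (∫ w, v w * stftZ g₁ f (m, w) * shiftZ m w g₂ k ∂haarT n) := by
  have hb : Summable fun r => ‖f r * starRingEnd ℂ (g₁ (r - m)) * g₂ (k - m)‖ := by
    simp only [norm_mul, RCLike.norm_conj]
    refine Summable.mul_right _ (.of_nonneg_of_le (fun r => by positivity) (fun r => ?_)
      (((Equiv.subRight m).summable_iff.2 h₁).mul_left ‖f‖))
    exact mul_le_mul_of_nonneg_right (lp.norm_apply_le_norm two_ne_zero f r) (norm_nonneg _)
  simp only [mul_assoc (v _), stftZ_mul_shiftZ]
  exact hasSum_integral_mul_of_summable hv (χ := fun r w => chr (k - r) w)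
    (fun r => (continuous_chr _).aestronglyMeasurable) (fun r w => (norm_chr _ _).le) hb

theorem isLocOpFun_coeffLocOp (h₁ : Summable fun k => ‖g₁ k‖) (h₂ : Summable fun k => ‖g₂ k‖)
    {u : Zn n × Tn n → ℂ} (hu : Integrable u (haarZT n)) {c : BddCoeff n}
    (hc : ∀ m j, c (m, j) = ∫ w, u (m, w) * chr (-j) w ∂haarT n) :
    IsLocOpFun g₁ g₂ u (coeffLocOp g₁ g₂ c) := by
  intro f k
  -- The index `(s, t)` of the weighted shifts corresponds to `(m, r) = (k - s, k - s + t)`.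
  let e : Zn n × Zn n ≃ Zn n × Zn n :=
    { toFun q := (k - q.1, q.2 - q.1)
      invFun q := (k - q.1, k - q.1 + q.2)
      left_inv q := by ext <;> simp
      right_inv q := by ext <;> simp }
  have hsum := e.hasSum_iff.2 (hasSum_coeffLocOp_apply_apply h₁ h₂ c f k)
  refine (hsum.prod_fiberwise fun m => ?_).tsum_eq.symm
  refine (hasSum_integral_mul_stftZ_mul_shiftZ h₁ (integrable_slice hu m) f k m).congr_fun
    fun r => ?_
  simp only [Function.comp_apply, e, Equiv.coe_fn_mk]
  rw [sub_sub_cancel, sub_sub_sub_cancel_right, add_sub_cancel, hc, neg_sub]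
  ring

theorem IsLocOpFun.unique {u : Zn n × Tn n → ℂ} {A B : ell2 n →L[ℂ] ell2 n}
    (hA : IsLocOpFun g₁ g₂ u A) (hB : IsLocOpFun g₁ g₂ u B) : A = B := by
  ext f k
  rw [hA, hB]

end LocOpFun

/-! ### Summable coefficients -/

section SummableCoefficients

open InnerProductSpace

variable {n : ℕ}

/-- The standard unit vectors of `ℓ²(ℤⁿ)`. -/
def unitVec (k : Zn n) : ell2 n := lp.single 2 k (1 : ℂ)

theorem norm_unitVec (k : Zn n) : ‖unitVec k‖ = 1 := by
  rw [unitVec, lp.norm_single two_pos, norm_one]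

theorem unitVec_apply (k l : Zn n) : unitVec k l = if l = k then 1 else 0 := by
  rw [unitVec, lp.single_apply, Pi.single_apply]

theorem inner_unitVec (k : Zn n) (f : ell2 n) : inner ℂ (unitVec k) f = f k := by
  rw [unitVec, lp.inner_single_left, RCLike.inner_apply, map_one, mul_one]

theorem summable_mul_comp_of_injective {α β γ : Type*} {a : α → ℝ} {c : γ → ℝ} (ha : Summable a)
    (ha0 : 0 ≤ a) (hc : Summable c) (hc0 : 0 ≤ c) {e : α → β → γ}
    (he : ∀ x, Function.Injective (e x)) :
    Summable fun p : α × β => a p.1 * c (e p.1 p.2) := by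
  refine (summable_prod_of_nonneg fun p => mul_nonneg (ha0 _) (hc0 _)).2
    ⟨fun x => (hc.comp_injective (he x)).mul_left (a x), ?_⟩
  refine .of_nonneg_of_le (fun x => tsum_nonneg fun y => mul_nonneg (ha0 _) (hc0 _)) (fun x => ?_)
    (ha.mul_right (∑' z, c z))
  refine (tsum_mul_left (a := a x)).trans_le ?_
  exact mul_le_mul_of_nonneg_left (tsum_comp_le_tsum_of_inj hc hc0 (he x)) (ha0 x)

variable {c : BddCoeff n} (hc : Summable fun q => ‖c q‖)

include hc

theorem hasSum_rankOne_weightedShift (s t : Zn n) :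
    HasSum (fun m => c (m, t - s) • rankOne ℂ (unitVec (m + s)) (unitVec (m + t)))
      (weightedShift s t c) := by
  have hs : Summable fun m => c (m, t - s) • rankOne ℂ (unitVec (m + s)) (unitVec (m + t)) := by
    refine .of_norm_bounded (hc.comp_injective (Prod.mk_left_injective (t - s))) fun m => ?_
    rw [norm_smul, norm_rankOne, norm_unitVec, norm_unitVec, mul_one, mul_one]
    rfl
  convert hs.hasSum
  ext f k
  have happly : HasSum (fun m => c (m, t - s) * (f (m + t) * if k = m + s then 1 else 0))
      ((∑' m, c (m, t - s) • rankOne ℂ (unitVec (m + s)) (unitVec (m + t))) f k) := by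
    refine ((hs.hasSum.mapL (ContinuousLinearMap.apply ℂ _ f)).mapL
      (lp.evalCLM ℂ (fun _ : Zn n => ℂ) 2 k)).congr_fun fun m => ?_
    rw [← inner_unitVec, ← unitVec_apply]
    rfl
  rw [happly.unique (hasSum_single (k - s) fun m hm => ?_), sub_add_cancel, if_pos rfl, mul_one,
    weightedShift_apply_apply]
  rw [if_neg fun h => hm (eq_sub_of_add_eq h.symm), mul_zero, mul_zero]

theorem isTraceClass_coeffLocOp {g₁ g₂ : Zn n → ℂ} (h₁ : Summable fun k => ‖g₁ k‖)
    (h₂ : Summable fun k => ‖g₂ k‖) : IsTraceClass (coeffLocOp g₁ g₂ c) := by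
  let x (i : (Zn n × Zn n) × Zn n) : ell2 n :=
    ((g₂ i.1.1 * starRingEnd ℂ (g₁ i.1.2)) * c (i.2, i.1.2 - i.1.1)) • unitVec (i.2 + i.1.1)
  let y (i : (Zn n × Zn n) × Zn n) : ell2 n := unitVec (i.2 + i.1.2)
  have hsum : Summable fun i => ‖x i‖ * ‖y i‖ := by
    refine (summable_mul_comp_of_injective (summable_norm_window_mul_window h₁ h₂)
      (fun _ => norm_nonneg _) hc (fun _ => norm_nonneg _)
      fun q : Zn n × Zn n => Prod.mk_left_injective (q.2 - q.1)).congr fun i => ?_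
    rw [norm_smul, norm_unitVec, norm_unitVec, norm_mul _ (c _), mul_one, mul_one]
  have hs : Summable fun i => rankOne ℂ (x i) (y i) :=
    .of_norm (by simpa only [norm_rankOne] using hsum)
  refine isTraceClass_of_hasSum_rankOne (x := x) (y := y) ?_ hsum
  convert hs.hasSum
  refine (hasSum_coeffLocOp h₁ h₂ c).unique (hs.hasSum.prod_fiberwise fun q => ?_)
  refine ((hasSum_rankOne_weightedShift hc q.1 q.2).const_smul
    (g₂ q.1 * starRingEnd ℂ (g₁ q.2))).congr_fun fun m => ?_
  simp only [x, y, map_smul, smul_apply, smul_smul]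

end SummableCoefficients

/-! ### Decay of Fourier coefficients -/

section Decay

variable {n : ℕ}

theorem integrable_of_continuous {F : Tn n → ℂ} (hF : Continuous F) : Integrable F (haarT n) :=
  hF.integrable_of_hasCompactSupport (.of_compactSpace F)

theorem mFourierCoeff_eq_integral_chr (F : Tn n → ℂ) (j : Zn n) :
    UnitAddTorus.mFourierCoeff F j = ∫ w, chr (-j) w * F w ∂haarT n :=
  rfl

theorem norm_mFourierCoeff_le {F : Tn n → ℂ} {C : ℝ} (hF : ∀ w, ‖F w‖ ≤ C) (j : Zn n) :
    ‖UnitAddTorus.mFourierCoeff F j‖ ≤ C := by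
  have h := norm_integral_le_of_norm_le_const (μ := haarT n) (f := fun w => chr (-j) w * F w)
    (C := C) (.of_forall fun w => by rw [norm_mul, norm_chr, one_mul]; exact hF w)
  rwa [probReal_univ, mul_one] at h

theorem mFourierCoeff_translate (F : Tn n → ℂ) (h : Tn n) (j : Zn n) :
    UnitAddTorus.mFourierCoeff (fun w => F (w - h)) j =
      chr (-j) h * UnitAddTorus.mFourierCoeff F j := by
  simp only [mFourierCoeff_eq_integral_chr]
  rw [← integral_const_mul, ← integral_add_right_eq_self _ h]
  refine integral_congr_ae (.of_forall fun w => ?_)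
  simp only [chr_add, add_sub_cancel_right]
  ring

theorem mFourierCoeff_sub_translate {F : Tn n → ℂ} (hF : Continuous F) (h : Tn n) (j : Zn n) :
    UnitAddTorus.mFourierCoeff (fun w => F w - F (w - h)) j =
      (1 - chr (-j) h) * UnitAddTorus.mFourierCoeff F j := by
  rw [sub_mul, one_mul, ← mFourierCoeff_translate]
  simp only [mFourierCoeff_eq_integral_chr, mul_sub]
  exact integral_sub (integrable_of_continuous ((continuous_chr _).mul hF))
    (integrable_of_continuous ((continuous_chr _).mul (hF.comp (continuous_sub_right h))))

theorem norm_iteratedFDeriv_sub_comp_sub_le {E V : Type*} [NormedAddCommGroup E]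
    [NormedSpace ℝ E] [NormedAddCommGroup V] [NormedSpace ℝ V] {f : E → V} {M : ℕ} {C : ℝ}
    (hf : ContDiff ℝ (M + 1) f) (hC : ∀ x, ‖iteratedFDeriv ℝ (M + 1) f x‖ ≤ C) (h x : E) :
    ‖iteratedFDeriv ℝ M (fun y => f y - f (y - h)) x‖ ≤ C * ‖h‖ := by
  have hM : ContDiff ℝ M f := hf.of_le le_self_add
  have hshift : ContDiff ℝ M fun y => f (y - h) := hM.comp (contDiff_id.sub contDiff_const)
  have hmean := convex_univ.norm_image_sub_le_of_norm_fderiv_le (𝕜 := ℝ)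
    (f := iteratedFDeriv ℝ M f) (C := C) (x := x - h) (y := x)
    (fun y _ => (hf.differentiable_iteratedFDeriv
      (by exact_mod_cast Nat.lt_succ_self M)).differentiableAt)
    (fun y _ => by rw [norm_fderiv_iteratedFDeriv]; exact hC y) trivial trivial
  rwa [sub_sub_cancel, ← iteratedFDeriv_comp_sub,
    ← iteratedFDeriv_sub_apply hM.contDiffAt hshift.contDiffAt] at hmean

/-- Passing from `F` to `F - F(· - h)` doubles the `j`-th coefficient and costs one derivative. -/
theorem two_pow_mul_norm_mFourierCoeff_le {j : Zn n} {h : Fin n → ℝ}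
    (hh : chr (-j) (toTorus h) = -1) {M : ℕ} {F : Tn n → ℂ} {C : ℝ}
    (hF : ContDiff ℝ M fun x => F (toTorus x))
    (hC : ∀ x, ‖iteratedFDeriv ℝ M (fun x => F (toTorus x)) x‖ ≤ C) :
    2 ^ M * ‖UnitAddTorus.mFourierCoeff F j‖ ≤ C * ‖h‖ ^ M := by
  induction M generalizing F C with
  | zero =>
    rw [pow_zero, pow_zero, one_mul, mul_one]
    refine norm_mFourierCoeff_le (fun w => ?_) j
    obtain ⟨x, rfl⟩ := isOpenQuotientMap_toTorus.surjective w
    simpa only [norm_iteratedFDeriv_zero] using hC x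
  | succ M ih =>
    have hlift : (fun x => F (toTorus x) - F (toTorus x - toTorus h)) =
        fun x => F (toTorus x) - F (toTorus (x - h)) := by
      simp only [toTorus_sub]
    have hM : ContDiff ℝ M fun x => F (toTorus x) := hF.of_le (by exact_mod_cast M.le_succ)
    have hdiff := ih (F := fun w => F w - F (w - toTorus h))
      (hlift ▸ hM.sub (hM.comp (contDiff_id.sub contDiff_const)))
      (hlift ▸ norm_iteratedFDeriv_sub_comp_sub_le (by exact_mod_cast hF) hC h)
    rw [mFourierCoeff_sub_translate
      (isOpenQuotientMap_toTorus.isQuotientMap.continuous_iff.2 hF.continuous), hh,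
      sub_neg_eq_add, one_add_one_eq_two, norm_mul, Complex.norm_two] at hdiff
    rwa [pow_succ, pow_succ', mul_assoc, ← mul_assoc C]

theorem one_le_norm_of_ne_zero {j : Zn n} (hj : j ≠ 0) : 1 ≤ ‖j‖ := by
  obtain ⟨i, hi⟩ := Function.ne_iff.1 hj
  refine le_trans ?_ (norm_le_pi_norm j i)
  rw [Int.norm_eq_abs]
  exact_mod_cast Int.one_le_abs hi

theorem one_add_pow_mul_norm_mFourierCoeff_le {F : Tn n → ℂ} {M : ℕ} {C D : ℝ}
    (hF : ContDiff ℝ M fun x => F (toTorus x)) (hC : ∀ w, ‖F w‖ ≤ C)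
    (hD : ∀ x, ‖iteratedFDeriv ℝ M (fun x => F (toTorus x)) x‖ ≤ D) (j : Zn n) :
    (1 + ‖j‖) ^ M * ‖UnitAddTorus.mFourierCoeff F j‖ ≤ C + D := by
  have hC0 : 0 ≤ C := (norm_nonneg _).trans (hC 0)
  have hD0 : 0 ≤ D := (norm_nonneg _).trans (hD 0)
  obtain rfl | hj := eq_or_ne j 0
  · rw [norm_zero, add_zero, one_pow, one_mul]
    exact (norm_mFourierCoeff_le hC 0).trans (le_add_of_nonneg_right hD0)
  · obtain ⟨h, hnorm, hh⟩ := exists_norm_eq_chr_eq_neg_one (neg_ne_zero.2 hj)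
    have hj1 := one_le_norm_of_ne_zero hj
    rw [norm_neg] at hnorm
    calc (1 + ‖j‖) ^ M * ‖UnitAddTorus.mFourierCoeff F j‖
        ≤ (2 * ‖j‖) ^ M * ‖UnitAddTorus.mFourierCoeff F j‖ := by gcongr; linarith
      _ ≤ (2 * ‖j‖) ^ M * (2 ^ M * ‖UnitAddTorus.mFourierCoeff F j‖) := by
          gcongr
          exact le_mul_of_one_le_left (norm_nonneg _) (one_le_pow₀ one_le_two)
      _ ≤ (2 * ‖j‖) ^ M * (D * ‖h‖ ^ M) := by
          gcongr (2 * ‖j‖) ^ M * ?_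
          exact two_pow_mul_norm_mFourierCoeff_le hh hF hD
      _ = D := by
          rw [hnorm, inv_pow, mul_comm, inv_mul_cancel_right₀ (by positivity)]
      _ ≤ C + D := le_add_of_nonneg_left hC0

theorem summable_int_inv_sq : Summable fun k : ℤ => ((1 + ‖k‖) ^ 2)⁻¹ := by
  refine .of_norm_bounded_eventually (Real.summable_one_div_int_pow.2 one_lt_two) ?_
  filter_upwards [(Set.finite_singleton (0 : ℤ)).compl_mem_cofinite] with k hk
  have hk' : (k : ℝ) ≠ 0 := Int.cast_ne_zero.2 hk
  rw [Real.norm_of_nonneg (by positivity), one_div, ← sq_abs (k : ℝ), Int.norm_eq_abs]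
  gcongr
  linarith

theorem summable_prod_pi {ι α : Type*} [Fintype ι] {f : α → ℝ} (hf : Summable f) (h0 : 0 ≤ f) :
    Summable fun k : ι → α => ∏ i, f (k i) := by
  classical
  refine summable_of_sum_le (c := ∏ _i : ι, ∑' k, f k)
    (fun k => Finset.prod_nonneg fun i _ => h0 _) fun s => ?_
  calc ∑ k ∈ s, ∏ i, f (k i)
      ≤ ∑ k ∈ Fintype.piFinset fun i => s.image fun k => k i, ∏ i, f (k i) :=
        Finset.sum_le_sum_of_subset_of_nonneg
          (fun k hk => Fintype.mem_piFinset.2 fun i => Finset.mem_image_of_mem _ hk)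
          fun k _ _ => Finset.prod_nonneg fun i _ => h0 _
    _ = ∏ i : ι, ∑ l ∈ s.image fun k => k i, f l := (Finset.prod_univ_sum _ _).symm
    _ ≤ ∏ _i : ι, ∑' k, f k := Finset.prod_le_prod
        (fun i _ => Finset.sum_nonneg fun l _ => h0 l)
        fun i _ => hf.sum_le_tsum _ fun l _ => h0 l

theorem summable_inv_one_add_norm_pow (n : ℕ) :
    Summable fun k : Zn n => ((1 + ‖k‖) ^ (2 * n))⁻¹ := by
  refine .of_nonneg_of_le (fun k => by positivity) (fun k => ?_)
    (summable_prod_pi summable_int_inv_sq fun k => inv_nonneg.2 (sq_nonneg _))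
  rw [Finset.prod_inv_distrib, Finset.prod_pow, mul_comm, pow_mul]
  gcongr
  calc ∏ i, (1 + ‖k i‖) ≤ ∏ _i : Fin n, (1 + ‖k‖) :=
        Finset.prod_le_prod (fun i _ => by positivity)
          fun i _ => add_le_add_right (norm_le_pi_norm k i) 1
    _ = (1 + ‖k‖) ^ n := by rw [Finset.prod_const, Finset.card_univ, Fintype.card_fin]

end Decay

/-! ### Fourier series of Schwartz functions -/

section FourierSeries

variable {n : ℕ}

/-- The Fourier coefficients of a Schwartz function in its torus variable. -/
def fourierZT (ψ : SchwartzZT n) (q : Zn n × Zn n) : ℂ :=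
  UnitAddTorus.mFourierCoeff (fun w => ψ.1 (q.1, w)) q.2

theorem contDiff_lift (ψ : SchwartzZT n) (N : ℕ) (m : Zn n) : ContDiff ℝ N (lift ψ.1 m) :=
  (ψ.2.1 m).of_le (by exact_mod_cast le_top)

theorem norm_le_of_forall_norm_lift_le {ψ : Zn n × Tn n → ℂ} {m : Zn n} {b : ℝ}
    (h : ∀ x, ‖lift ψ m x‖ ≤ b) (w : Tn n) : ‖ψ (m, w)‖ ≤ b := by
  obtain ⟨x, rfl⟩ := isOpenQuotientMap_toTorus.surjective w
  exact h x

theorem exists_norm_schwartzZT_le (ψ : SchwartzZT n) (M : ℕ) :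
    ∃ C, ∀ z, ‖ψ.1 z‖ ≤ C / (1 + ‖z.1‖) ^ M := by
  obtain ⟨C, hC⟩ := ψ.2.2 M 0
  refine ⟨C, fun z => norm_le_of_forall_norm_lift_le (fun x => ?_) z.2⟩
  simpa only [norm_iteratedFDeriv_zero, ← le_div_iff₀' (show 0 < (1 + ‖z.1‖) ^ M by positivity)]
    using hC z.1 x

theorem exists_pow_mul_norm_fourierZT_le (ψ : SchwartzZT n) (M N : ℕ) :
    ∃ C : ℝ, ∀ q, (1 + ‖q.1‖) ^ M * ((1 + ‖q.2‖) ^ N * ‖fourierZT ψ q‖) ≤ C := by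
  obtain ⟨C, hC⟩ := exists_norm_schwartzZT_le ψ M
  obtain ⟨D, hD⟩ := ψ.2.2 M N
  refine ⟨C + D, fun q => ?_⟩
  have hp : 0 < (1 + ‖q.1‖) ^ M := by positivity
  rw [← le_div_iff₀' hp, add_div]
  exact one_add_pow_mul_norm_mFourierCoeff_le (F := fun w => ψ.1 (q.1, w))
    (contDiff_lift ψ N q.1) (fun w => hC (q.1, w)) (fun x => (le_div_iff₀' hp).2 (hD q.1 x)) q.2

theorem summable_pow_mul_norm_fourierZT (ψ : SchwartzZT n) (M N : ℕ) :
    Summable fun q => (1 + ‖q.1‖) ^ M * ((1 + ‖q.2‖) ^ N * ‖fourierZT ψ q‖) := by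
  obtain ⟨C, hC⟩ := exists_pow_mul_norm_fourierZT_le ψ (M + 2 * n) (N + 2 * n)
  have hsum := summable_inv_one_add_norm_pow n
  refine .of_nonneg_of_le (fun q => by positivity) (fun q => ?_)
    ((hsum.mul_of_nonneg hsum (fun q => by positivity) (fun q => by positivity)).mul_left C)
  rw [← mul_inv, ← div_eq_mul_inv, le_div_iff₀ (by positivity)]
  refine le_trans (le_of_eq ?_) (hC q)
  ring

theorem summable_norm_fourierZT (ψ : SchwartzZT n) : Summable fun q => ‖fourierZT ψ q‖ := by
  simpa only [pow_zero, one_mul] using summable_pow_mul_norm_fourierZT ψ 0 0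

theorem continuous_slice (ψ : SchwartzZT n) (m : Zn n) : Continuous fun w => ψ.1 (m, w) :=
  isOpenQuotientMap_toTorus.isQuotientMap.continuous_iff.2 (ψ.2.1 m).continuous

theorem hasSum_fourierZT (ψ : SchwartzZT n) (m : Zn n) (w : Tn n) :
    HasSum (fun j => fourierZT ψ (m, j) * chr j w) (ψ.1 (m, w)) := by
  have hs : Summable fun j => fourierZT ψ (m, j) :=
    ((summable_norm_fourierZT ψ).comp_injective (Prod.mk_right_injective m)).of_norm
  exact UnitAddTorus.hasSum_mFourier_series_apply_of_summable
    (f := ⟨fun w => ψ.1 (m, w), continuous_slice ψ m⟩) hs w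

theorem contDiff_of_hasFDerivAt_smul {E : Type*} [NormedAddCommGroup E] [NormedSpace ℝ E]
    {f : E → ℂ} {L : E →L[ℝ] ℂ} (hf : ∀ x, HasFDerivAt f (f x • L) x) (i : ℕ) :
    ContDiff ℝ i f := by
  induction i with
  | zero => exact contDiff_zero.2 (continuous_iff_continuousAt.2 fun x => (hf x).continuousAt)
  | succ i ih =>
    refine contDiff_succ_iff_hasFDerivAt.2 ⟨fun x => f x • L, ?_, hf⟩
    exact ih.smul contDiff_const

theorem norm_iteratedFDeriv_le_of_hasFDerivAt_smul {E : Type*} [NormedAddCommGroup E]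
    [NormedSpace ℝ E] {f : E → ℂ} {L : E →L[ℝ] ℂ} (hf : ∀ x, HasFDerivAt f (f x • L) x) (i : ℕ)
    (x : E) : ‖iteratedFDeriv ℝ i f x‖ ≤ ‖L‖ ^ i * ‖f x‖ := by
  induction i with
  | zero => rw [norm_iteratedFDeriv_zero, pow_zero, one_mul]
  | succ i ih =>
    let T : ℂ →L[ℝ] E →L[ℝ] ℂ := (ContinuousLinearMap.lsmul ℝ ℂ).flip L
    have hfderiv : fderiv ℝ f = T ∘ f := funext fun y => (hf y).fderiv
    have hT : ‖T‖ ≤ ‖L‖ := ContinuousLinearMap.opNorm_le_bound _ (norm_nonneg L) fun z =>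
      (norm_smul_le z L).trans_eq (mul_comm _ _)
    rw [← norm_iteratedFDeriv_fderiv, hfderiv, pow_succ', mul_assoc]
    exact (T.norm_iteratedFDeriv_comp_left (contDiff_of_hasFDerivAt_smul hf i).contDiffAt
      le_rfl).trans (mul_le_mul hT ih (norm_nonneg _) (norm_nonneg _))

/-- A bound for the derivative of the character `e^{2πi w·j}`. The summands `1` make it at least
one, so that its powers increase with the exponent. -/
def freqBound (j : Zn n) : ℝ := 2 * Real.pi * (n + 1) * (1 + ‖j‖)

theorem one_le_freqBound (j : Zn n) : 1 ≤ freqBound j := by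
  have hπ : 1 ≤ 2 * Real.pi := by linarith [Real.pi_gt_three]
  exact one_le_mul_of_one_le_of_one_le (one_le_mul_of_one_le_of_one_le hπ
    (le_add_of_nonneg_left (Nat.cast_nonneg n))) (le_add_of_nonneg_right (norm_nonneg j))

/-- The linear functional `x ↦ 2πi j·x`, the logarithmic derivative of `e^{2πi x·j}`. -/
def phaseCLM (j : Zn n) : (Fin n → ℝ) →L[ℝ] ℂ :=
  (2 * Real.pi * Complex.I) • Complex.ofRealCLM.comp
    (∑ r, (j r : ℝ) • ContinuousLinearMap.proj (R := ℝ) (φ := fun _ : Fin n => ℝ) r)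

theorem phaseCLM_apply (j : Zn n) (x : Fin n → ℝ) :
    phaseCLM j x = 2 * Real.pi * Complex.I * ∑ i, (j i : ℝ) * x i := by
  simp [phaseCLM]

theorem norm_phaseCLM_le (j : Zn n) : ‖phaseCLM j‖ ≤ freqBound j := by
  refine ContinuousLinearMap.opNorm_le_bound _ (zero_le_one.trans (one_le_freqBound j)) fun x => ?_
  have hsum : |∑ i, (j i : ℝ) * x i| ≤ n * (‖j‖ * ‖x‖) := by
    refine (Finset.abs_sum_le_sum_abs _ _).trans
      ((Finset.sum_le_card_nsmul _ _ (‖j‖ * ‖x‖) fun i _ => ?_).trans_eq ?_)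
    · rw [abs_mul, ← Int.norm_eq_abs, ← Real.norm_eq_abs]
      exact mul_le_mul (norm_le_pi_norm j i) (norm_le_pi_norm x i) (norm_nonneg _) (norm_nonneg _)
    · rw [Finset.card_univ, Fintype.card_fin, nsmul_eq_mul]
  have hπ : ‖(2 * Real.pi * Complex.I : ℂ)‖ = 2 * Real.pi := by
    simp [abs_of_pos Real.pi_pos]
  calc ‖phaseCLM j x‖ = 2 * Real.pi * |∑ i, (j i : ℝ) * x i| := by
        rw [phaseCLM_apply, norm_mul, hπ, Complex.norm_real, Real.norm_eq_abs]
    _ ≤ 2 * Real.pi * ((n + 1) * ((1 + ‖j‖) * ‖x‖)) := by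
        gcongr
        refine hsum.trans ?_
        gcongr <;> linarith
    _ = freqBound j * ‖x‖ := by rw [freqBound]; ring

theorem norm_iteratedFDeriv_chr_le (j : Zn n) (i : ℕ) (x : Fin n → ℝ) :
    ‖iteratedFDeriv ℝ i (fun x => chr j (toTorus x)) x‖ ≤ freqBound j ^ i := by
  have hderiv (x : Fin n → ℝ) :
      HasFDerivAt (fun x => chr j (toTorus x)) (chr j (toTorus x) • phaseCLM j) x := by
    simp only [chr_toTorus, ← phaseCLM_apply]
    exact (phaseCLM j).hasFDerivAt.cexp
  refine (norm_iteratedFDeriv_le_of_hasFDerivAt_smul hderiv i x).trans ?_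
  rw [norm_chr, mul_one]
  exact pow_le_pow_left₀ (norm_nonneg _) (norm_phaseCLM_le j) i

theorem one_add_pow_mul_norm_iteratedFDeriv_ite_le (k j m : Zn n) (M i : ℕ) (x : Fin n → ℝ) :
    (1 + ‖m‖) ^ M * ‖iteratedFDeriv ℝ i (fun x => if m = k then chr j (toTorus x) else 0) x‖ ≤
      (1 + ‖k‖) ^ M * freqBound j ^ i := by
  split_ifs with h
  · rw [h]
    gcongr
    exact norm_iteratedFDeriv_chr_le j i x
  · rw [iteratedFDeriv_fun_zero, Pi.zero_apply, norm_zero, mul_zero]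
    have := zero_le_one.trans (one_le_freqBound j)
    positivity

/-- The function `δ_k ⊗ e_j` on `ℤⁿ × 𝕋ⁿ`, where `e_j(w) = e^{2πi w·j}`. -/
def tensorZT (k j : Zn n) : SchwartzZT n :=
  ⟨fun z => if z.1 = k then chr j z.2 else 0, fun m => by
    change ContDiff ℝ ∞ fun x => if m = k then chr j (toTorus x) else 0
    split_ifs
    exacts [contDiff_chr j, contDiff_const], fun M i =>
    ⟨_, fun m => one_add_pow_mul_norm_iteratedFDeriv_ite_le k j m M i⟩⟩

theorem tensorZT_apply (k j : Zn n) (z : Zn n × Tn n) :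
    (tensorZT k j).1 z = if z.1 = k then chr j z.2 else 0 :=
  rfl

theorem hasSum_fourierZT_smul_tensorZT (ψ : SchwartzZT n) (z : Zn n × Tn n) :
    HasSum (fun q : Zn n × Zn n => (fourierZT ψ q • tensorZT q.1 q.2).1 z) (ψ.1 z) := by
  refine ((Prod.mk_right_injective z.1).hasSum_iff fun q hq => ?_).1 ?_
  · have hz : z.1 ≠ q.1 := fun h => hq ⟨q.2, by rw [h]⟩
    rw [Submodule.coe_smul, Pi.smul_apply, tensorZT_apply, if_neg hz, smul_zero]
  · refine (hasSum_fourierZT ψ z.1 z.2).congr_fun fun j => ?_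
    rw [Function.comp_apply, Submodule.coe_smul, Pi.smul_apply, tensorZT_apply, if_pos rfl,
      smul_eq_mul]

end FourierSeries

/-! ### Expansion of tempered distributions -/

section Tempered

variable {n : ℕ}

/-- The seminorms of order at most `N` that define the topology of `𝓢(ℤⁿ × 𝕋ⁿ)` are at most `b`
at `ψ`. -/
def SeminormLE (N : ℕ) (ψ : SchwartzZT n) (b : ℝ) : Prop :=
  ∀ M ≤ N, ∀ j ≤ N, ∀ m x, (1 + ‖m‖) ^ M * ‖iteratedFDeriv ℝ j (lift ψ.1 m) x‖ ≤ b

theorem SeminormLE.smul {N : ℕ} {ψ : SchwartzZT n} {b : ℝ} (hψ : SeminormLE N ψ b) (c : ℂ) :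
    SeminormLE N (c • ψ) (‖c‖ * b) := by
  intro M hM j hj m x
  change (1 + ‖m‖) ^ M * ‖iteratedFDeriv ℝ j (c • lift ψ.1 m) x‖ ≤ _
  rw [iteratedFDeriv_const_smul_apply (contDiff_lift ψ j m).contDiffAt,
    norm_smul, mul_left_comm]
  exact mul_le_mul_of_nonneg_left (hψ M hM j hj m x) (norm_nonneg c)

theorem seminormLE_tensorZT (N : ℕ) (k j : Zn n) :
    SeminormLE N (tensorZT k j) ((1 + ‖k‖) ^ N * freqBound j ^ N) := by
  intro M hM i hi m x
  refine (one_add_pow_mul_norm_iteratedFDeriv_ite_le k j m M i x).trans ?_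
  have hj := one_le_freqBound j
  gcongr
  exact le_add_of_nonneg_right (norm_nonneg k)

theorem SeminormLE.norm_iteratedFDeriv_le {N : ℕ} {ψ : SchwartzZT n} {b : ℝ}
    (hψ : SeminormLE N ψ b) {j : ℕ} (hj : j ≤ N) (m : Zn n) (x : Fin n → ℝ) :
    ‖iteratedFDeriv ℝ j (lift ψ.1 m) x‖ ≤ b := by
  simpa only [pow_zero, one_mul] using hψ 0 N.zero_le j hj m x

theorem iteratedFDeriv_lift_of_hasSum {ι : Type*} {N : ℕ} {F : ι → SchwartzZT n} {b : ι → ℝ}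
    (hF : ∀ i, SeminormLE N (F i) (b i)) (hb : Summable b) {ψ : SchwartzZT n}
    (hψ : ∀ z, HasSum (fun i => (F i).1 z) (ψ.1 z)) {j : ℕ} (hj : j ≤ N) (m : Zn n)
    (x : Fin n → ℝ) :
    iteratedFDeriv ℝ j (lift ψ.1 m) x = ∑' i, iteratedFDeriv ℝ j (lift (F i).1 m) x := by
  have hlift : lift ψ.1 m = fun x => ∑' i, lift (F i).1 m x :=
    funext fun x => (hψ (m, toTorus x)).tsum_eq.symm
  rw [hlift]
  exact iteratedFDeriv_tsum_apply (N := N) (v := fun _ => b) (fun i => contDiff_lift (F i) N m)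
    (fun _ _ => hb)
    (fun k i x hk => (hF i).norm_iteratedFDeriv_le (Nat.cast_le.1 hk) m x) (Nat.cast_le.2 hj) x

theorem seminormLE_of_hasSum {ι : Type*} {N : ℕ} {F : ι → SchwartzZT n} {b : ι → ℝ}
    (hF : ∀ i, SeminormLE N (F i) (b i)) (hb : Summable b) {ψ : SchwartzZT n}
    (hψ : ∀ z, HasSum (fun i => (F i).1 z) (ψ.1 z)) : SeminormLE N ψ (∑' i, b i) := by
  intro M hM j hj m x
  have hpos : 0 < (1 + ‖m‖) ^ M := by positivity
  rw [iteratedFDeriv_lift_of_hasSum hF hb hψ hj, ← le_div_iff₀' hpos, ← tsum_div_const]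
  exact tsum_of_norm_bounded (hb.div_const _).hasSum fun i =>
    (le_div_iff₀' hpos).2 (hF i M hM j hj m x)

theorem IsTemperedZT.hasSum_apply {σ : SchwartzZT n →ₗ[ℂ] ℂ} (hσ : IsTemperedZT σ) {ι : Type*}
    {F : ι → SchwartzZT n} {b : ℕ → ι → ℝ} (hF : ∀ N i, SeminormLE N (F i) (b N i))
    (hb : ∀ N, Summable (b N)) {ψ : SchwartzZT n}
    (hψ : ∀ z, HasSum (fun i => (F i).1 z) (ψ.1 z)) : HasSum (fun i => σ (F i)) (σ ψ) := by
  obtain ⟨N, C, hC⟩ := hσ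
  have htail := (tendsto_tsum_compl_atTop_zero (b N)).const_mul C
  rw [mul_zero] at htail
  rw [HasSum, SummationFilter.unconditional_filter, tendsto_iff_norm_sub_tendsto_zero]
  refine squeeze_zero (fun _ => norm_nonneg _) (fun s => ?_) htail
  have hrest (z : Zn n × Tn n) :
      HasSum (fun i : {i // i ∉ s} => (F i).1 z) ((ψ - ∑ i ∈ s, F i : SchwartzZT n).1 z) := by
    rw [Submodule.coe_sub, Submodule.coe_sum, Pi.sub_apply, Finset.sum_apply]
    exact (s.hasSum_compl_iff (f := fun i => (F i).1 z)).2 (by simpa using hψ z)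
  rw [norm_sub_rev, ← map_sum, ← map_sub]
  exact hC _ _ (seminormLE_of_hasSum (F := fun i : {i // i ∉ s} => F i) (fun i => hF N i)
    ((hb N).subtype _) hrest)

theorem IsTemperedZT.hasSum_fourierZT {σ : SchwartzZT n →ₗ[ℂ] ℂ} (hσ : IsTemperedZT σ)
    (ψ : SchwartzZT n) :
    HasSum (fun q : Zn n × Zn n => fourierZT ψ q * σ (tensorZT q.1 q.2)) (σ ψ) := by
  have hb (N : ℕ) : Summable fun q : Zn n × Zn n =>
      ‖fourierZT ψ q‖ * ((1 + ‖q.1‖) ^ N * freqBound q.2 ^ N) := by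
    refine ((summable_pow_mul_norm_fourierZT ψ N N).mul_left
      ((2 * Real.pi * (n + 1)) ^ N)).congr fun q => ?_
    rw [freqBound, mul_pow _ (1 + ‖q.2‖)]
    ring
  have h := hσ.hasSum_apply (F := fun q : Zn n × Zn n => fourierZT ψ q • tensorZT q.1 q.2)
    (fun N q => (seminormLE_tensorZT N q.1 q.2).smul (fourierZT ψ q)) hb
    (hasSum_fourierZT_smul_tensorZT ψ)
  simpa only [map_smul, smul_eq_mul] using h

end Tempered

/-! ### Measures on phase space -/

section PhaseSpace

variable {n : ℕ}

theorem count_prod_count {α β : Type*} [MeasurableSpace α] [MeasurableSpace β] [Countable α]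
    [Countable β] [MeasurableSingletonClass α] [MeasurableSingletonClass β] :
    (Measure.count.prod Measure.count : Measure (α × β)) = Measure.count := by
  refine Measure.ext_of_singleton fun q => ?_
  rw [← Set.singleton_prod_singleton, Measure.prod_prod, Set.singleton_prod_singleton]
  simp only [Measure.count_singleton, one_mul]

theorem measurePreserving_add_discrete (q : Zn n × Zn n) :
    MeasurePreserving (fun z : (Zn n × Tn n) × (Tn n × Zn n) => q + (z.1.1, z.2.2))
      (haarPhase n) Measure.count := by
  have h : MeasurePreserving (Prod.map Prod.fst Prod.snd :
      (Zn n × Tn n) × (Tn n × Zn n) → Zn n × Zn n) (haarPhase n)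
        (Measure.count.prod Measure.count) :=
    (measurePreserving_fst (μ := Measure.count) (ν := haarT n)).prod
      (measurePreserving_snd (μ := haarT n) (ν := Measure.count))
  rw [count_prod_count] at h
  exact (measurePreserving_add_left Measure.count q).comp h

theorem lintegral_haarPhase {f : (Zn n × Tn n) × (Tn n × Zn n) → ENNReal} (hf : Measurable f) :
    ∫⁻ z, f z ∂haarPhase n = ∑' q : Zn n × Zn n,
      ∫⁻ v : Tn n × Tn n, f ((q.1, v.1), (v.2, q.2)) ∂(haarT n).prod (haarT n) := by
  have hslice (m l : Zn n) : Measurable fun v : Tn n × Tn n => f ((m, v.1), (v.2, l)) :=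
    hf.comp (by fun_prop)
  calc ∫⁻ z, f z ∂haarPhase n
      = ∑' m, ∫⁻ w, ∑' l, ∫⁻ x, f ((m, w), (x, l)) ∂haarT n ∂haarT n := by
        rw [haarPhase, lintegral_prod _ hf.aemeasurable, haarZT,
          lintegral_prod _ hf.lintegral_prod_right'.aemeasurable, lintegral_count]
        refine tsum_congr fun m => lintegral_congr fun w => ?_
        rw [lintegral_prod_symm' (fun y => f ((m, w), y)) (hf.comp measurable_prodMk_left),
          lintegral_count]
    _ = ∑' m, ∑' l, ∫⁻ v : Tn n × Tn n, f ((m, v.1), (v.2, l)) ∂(haarT n).prod (haarT n) := by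
        refine tsum_congr fun m => ?_
        rw [lintegral_tsum fun l => (hslice m l).lintegral_prod_right'.aemeasurable]
        exact tsum_congr fun l => (lintegral_prod _ (hslice m l).aemeasurable).symm
    _ = _ := ENNReal.tsum_prod.symm

theorem measurable_of_continuous_torus {E : Type*} [TopologicalSpace E] [MeasurableSpace E]
    [BorelSpace E] {f : (Zn n × Tn n) × (Tn n × Zn n) → E}
    (hf : ∀ m l, Continuous fun v : Tn n × Tn n => f ((m, v.1), (v.2, l))) : Measurable f := by
  have h : Measurable fun y : (Zn n × Zn n) × (Tn n × Tn n) =>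
      f ((y.1.1, y.2.1), (y.2.2, y.1.2)) :=
    measurable_from_prod_countable_right fun q => (hf q.1 q.2).measurable
  exact h.comp (f := fun z : (Zn n × Tn n) × (Tn n × Zn n) => ((z.1.1, z.2.2), (z.1.2, z.2.1)))
    (by fun_prop)

/-- The characters `(w, x) ↦ e^{2πi (l·w - m·x)}` of `𝕋ⁿ × 𝕋ⁿ`, indexed by `(m, l)`. -/
def dualChr (q : Zn n × Zn n) (v : Tn n × Tn n) : ℂ := chr q.2 v.1 * chr (-q.1) v.2

theorem norm_dualChr (q : Zn n × Zn n) (v : Tn n × Tn n) : ‖dualChr q v‖ = 1 := by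
  rw [dualChr, norm_mul, norm_chr, norm_chr, one_mul]

theorem continuous_dualChr (q : Zn n × Zn n) : Continuous (dualChr q) :=
  ((continuous_chr q.2).comp continuous_fst).mul ((continuous_chr (-q.1)).comp continuous_snd)

theorem integral_conj_dualChr_mul_dualChr (q r : Zn n × Zn n) :
    ∫ v, starRingEnd ℂ (dualChr q v) * dualChr r v ∂(haarT n).prod (haarT n) =
      if r = q then 1 else 0 := by
  have h (v : Tn n × Tn n) : starRingEnd ℂ (dualChr q v) * dualChr r v =
      chr (r.2 - q.2) v.1 * chr (-r.1 - -q.1) v.2 := by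
    rw [dualChr, dualChr, map_mul, mul_mul_mul_comm, conj_chr_mul_chr, conj_chr_mul_chr]
  simp only [h]
  rw [integral_prod_mul, integral_chr, integral_chr, ite_zero_mul_ite_zero, mul_one]
  simp only [sub_eq_zero, neg_inj, Prod.ext_iff, and_comm]

end PhaseSpace

/-! ### The modulation norm in terms of Fourier coefficients -/

section Modulation

variable {n : ℕ} {σ : SchwartzZT n →ₗ[ℂ] ℂ} {p : ENNReal}

/-- The Fourier coefficients of a distribution on `ℤⁿ × 𝕋ⁿ` in its torus variable. -/
def coeffZT (σ : SchwartzZT n →ₗ[ℂ] ℂ) (q : Zn n × Zn n) : ℂ := σ (tensorZT q.1 (-q.2))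

theorem coeffZT_sub (σ τ : SchwartzZT n →ₗ[ℂ] ℂ) : coeffZT (σ - τ) = coeffZT σ - coeffZT τ :=
  rfl

theorem IsTemperedZT.sub {τ : SchwartzZT n →ₗ[ℂ] ℂ} (hσ : IsTemperedZT σ)
    (hτ : IsTemperedZT τ) : IsTemperedZT (σ - τ) := by
  obtain ⟨N, C, hC⟩ := hσ
  obtain ⟨N', C', hC'⟩ := hτ
  refine ⟨max N N', C + C', fun φ b h => ?_⟩
  rw [LinearMap.sub_apply, add_mul]
  exact (norm_sub_le _ _).trans (add_le_add
    (hC φ b fun M hM j hj => h M (hM.trans (le_max_left _ _)) j (hj.trans (le_max_left _ _)))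
    (hC' φ b fun M hM j hj => h M (hM.trans (le_max_right _ _)) j (hj.trans (le_max_right _ _))))

theorem fourierZT_timeFrequencyShift (Φ : SchwartzZT n) (z : (Zn n × Tn n) × (Tn n × Zn n))
    (q : Zn n × Zn n) :
    fourierZT (conjZT (modulateZT z.2 (translateZT z.1 Φ))) (q.1 + z.1.1, -(q.2 + z.2.2)) =
      starRingEnd ℂ (fourierZT Φ q) * dualChr (q + (z.1.1, 0)) (z.1.2, z.2.1) := by
  obtain ⟨⟨m, w⟩, x, l⟩ := z
  have hshift (v : Tn n) : chr (- -(q.2 + l)) v *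
      starRingEnd ℂ (chr (q.1 + m) x * chr l v * Φ.1 ((q.1 + m, v) - (m, w))) =
      starRingEnd ℂ (chr (q.1 + m) x * (chr (-q.2) v * Φ.1 (q.1, v - w))) := by
    have hl := conj_chr_mul_chr l (q.2 + l) v
    rw [add_sub_cancel_right] at hl
    rw [Prod.mk_sub_mk, add_sub_cancel_right, neg_neg, chr_neg]
    simp only [map_mul, Complex.conj_conj]
    rw [← hl]
    ring
  calc fourierZT (conjZT (modulateZT (x, l) (translateZT (m, w) Φ))) (q.1 + m, -(q.2 + l))
      = ∫ v, starRingEnd ℂ (chr (q.1 + m) x * (chr (-q.2) v * Φ.1 (q.1, v - w))) ∂haarT n :=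
        integral_congr_ae (.of_forall hshift)
    _ = starRingEnd ℂ (chr (q.1 + m) x * (chr (-q.2) w * fourierZT Φ q)) := by
        rw [integral_conj, integral_const_mul]
        exact congrArg (fun y => starRingEnd ℂ (chr (q.1 + m) x * y))
          (mFourierCoeff_translate (fun v => Φ.1 (q.1, v)) w q.2)
    _ = _ := by
        rw [dualChr, map_mul, map_mul, ← chr_neg, ← chr_neg, neg_neg, Prod.fst_add, Prod.snd_add,
          add_zero]
        ring

theorem IsTemperedZT.hasSum_stftZT (hσ : IsTemperedZT σ) (Φ : SchwartzZT n)
    (z : (Zn n × Tn n) × (Tn n × Zn n)) :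
    HasSum (fun q => starRingEnd ℂ (fourierZT Φ q) * coeffZT σ (q + (z.1.1, z.2.2)) *
      dualChr (q + (z.1.1, 0)) (z.1.2, z.2.1)) (stftZT Φ σ z) := by
  let e : Zn n × Zn n ≃ Zn n × Zn n :=
    (Equiv.addRight z.1.1).prodCongr ((Equiv.addRight z.2.2).trans (Equiv.neg _))
  refine (e.hasSum_iff.2 (hσ.hasSum_fourierZT _)).congr_fun fun q => ?_
  rw [mul_right_comm, ← fourierZT_timeFrequencyShift]
  rfl

theorem IsTemperedZT.summable_norm_fourierZT_mul_coeffZT (hσ : IsTemperedZT σ) (Φ : SchwartzZT n)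
    (r : Zn n × Zn n) :
    Summable fun q => ‖starRingEnd ℂ (fourierZT Φ q) * coeffZT σ (q + r)‖ := by
  refine (hσ.hasSum_stftZT Φ ((r.1, 0), (0, r.2))).summable.norm.congr fun q => ?_
  rw [norm_mul _ (dualChr _ _), norm_dualChr, mul_one]

theorem IsTemperedZT.measurable_stftZT (hσ : IsTemperedZT σ) (Φ : SchwartzZT n) :
    Measurable (stftZT Φ σ) := by
  refine measurable_of_continuous_torus fun m l => ?_
  simp only [← (hσ.hasSum_stftZT Φ _).tsum_eq]
  refine continuous_tsum (fun q => continuous_const.mul (continuous_dualChr _))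
    (hσ.summable_norm_fourierZT_mul_coeffZT Φ (m, l)) fun q v => ?_
  rw [norm_mul _ (dualChr _ _), norm_dualChr, mul_one]

theorem IsTemperedZT.modulationNormZT_le (hσ : IsTemperedZT σ) (Φ : SchwartzZT n) (hp : 1 ≤ p) :
    modulationNormZT Φ p σ ≤
      (∑' q, ‖fourierZT Φ q‖ₑ) * eLpNorm (coeffZT σ) p Measure.count := by
  have hmeas (q : Zn n × Zn n) : Measurable fun z : (Zn n × Tn n) × (Tn n × Zn n) =>
      starRingEnd ℂ (fourierZT Φ q) * coeffZT σ (q + (z.1.1, z.2.2)) *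
        dualChr (q + (z.1.1, 0)) (z.1.2, z.2.1) :=
    measurable_of_continuous_torus fun m l => (continuous_dualChr (q + (m, 0))).const_mul
      (starRingEnd ℂ (fourierZT Φ q) * coeffZT σ (q + (m, l)))
  refine (eLpNorm_le_tsum_of_hasSum hp (fun q => (hmeas q).aestronglyMeasurable)
    (hσ.hasSum_stftZT Φ)).trans_eq ?_
  rw [← ENNReal.tsum_mul_right]
  refine tsum_congr fun q => ?_
  rw [← eLpNorm_comp_measurePreserving (measurable_of_countable _).aestronglyMeasurable
    (measurePreserving_add_discrete q), ← RCLike.enorm_conj (fourierZT Φ q), ← eLpNorm_const_smul]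
  refine eLpNorm_congr_norm_ae (.of_forall fun z => ?_)
  rw [norm_mul _ (dualChr _ _), norm_dualChr, mul_one]
  rfl

theorem IsTemperedZT.enorm_coeffZT_le_lintegral (hσ : IsTemperedZT σ) (Φ : SchwartzZT n)
    (q r : Zn n × Zn n) :
    ‖fourierZT Φ r‖ₑ * ‖coeffZT σ (r + q)‖ₑ ≤
      ∫⁻ v : Tn n × Tn n, ‖stftZT Φ σ ((q.1, v.1), (v.2, q.2))‖ₑ ∂(haarT n).prod (haarT n) := by
  rw [← RCLike.enorm_conj (fourierZT Φ r), ← enorm_mul]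
  refine enorm_coeff_le_lintegral_of_hasSum (χ := fun s => dualChr (s + (q.1, 0)))
    (b := fun s => starRingEnd ℂ (fourierZT Φ s) * coeffZT σ (s + q))
    (fun s => (continuous_dualChr _).aestronglyMeasurable) (fun s v => (norm_dualChr _ v).le)
    ?_ (fun s hs => ?_) (hσ.summable_norm_fourierZT_mul_coeffZT Φ q) fun v =>
      hσ.hasSum_stftZT Φ ((q.1, v.1), (v.2, q.2))
  · rw [integral_conj_dualChr_mul_dualChr, if_pos rfl]
  · rw [integral_conj_dualChr_mul_dualChr, if_neg (mt add_right_cancel hs)]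

theorem IsTemperedZT.enorm_mul_eLpNorm_coeffZT_le (hσ : IsTemperedZT σ) (Φ : SchwartzZT n)
    (r : Zn n × Zn n) (hp1 : 1 ≤ p) (hp : p ≠ ⊤) :
    ‖fourierZT Φ r‖ₑ * eLpNorm (coeffZT σ) p Measure.count ≤ modulationNormZT Φ p σ := by
  have hp0 : p ≠ 0 := (zero_lt_one.trans_le hp1).ne'
  have hmeas := hσ.measurable_stftZT Φ
  rw [modulationNormZT, ← eLpNorm_comp_measurePreserving
    (measurable_of_countable _).aestronglyMeasurable (measurePreserving_add_left Measure.count r),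
    ← eLpNorm_const_smul, eLpNorm_eq_lintegral_rpow_enorm_toReal hp0 hp,
    eLpNorm_eq_lintegral_rpow_enorm_toReal hp0 hp, lintegral_count,
    lintegral_haarPhase (hmeas.enorm.pow_const _)]
  gcongr with q
  have hq : Measurable fun v : Tn n × Tn n => stftZT Φ σ ((q.1, v.1), (v.2, q.2)) :=
    hmeas.comp (by fun_prop)
  have hmono := eLpNorm_le_eLpNorm_of_exponent_le (μ := (haarT n).prod (haarT n)) hp1
    hq.aestronglyMeasurable
  rw [eLpNorm_one_eq_lintegral_enorm, eLpNorm_eq_lintegral_rpow_enorm_toReal hp0 hp, one_div,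
    ENNReal.le_rpow_inv_iff (ENNReal.toReal_pos hp0 hp)] at hmono
  refine le_trans ?_ hmono
  gcongr
  refine le_trans (le_of_eq ?_) (hσ.enorm_coeffZT_le_lintegral Φ q r)
  rw [← enorm_mul]
  rfl

theorem exists_fourierZT_ne_zero {Φ : SchwartzZT n} (hΦ : Φ ≠ 0) : ∃ r, fourierZT Φ r ≠ 0 := by
  contrapose! hΦ
  refine Subtype.ext (funext fun z => ?_)
  have h := hasSum_fourierZT Φ z.1 z.2
  simp only [hΦ, zero_mul] at h
  exact h.unique hasSum_zero

end Modulation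

/-! ### Windows -/

section Windows

variable {n : ℕ} {φ g : Zn n → ℂ}

theorem summable_norm_mul_conj_sub (hφ : IsSchwartzZ φ) (hg : IsTemperedZ g) (m : Zn n) :
    Summable fun k => ‖g k * starRingEnd ℂ (φ (k - m))‖ := by
  obtain ⟨M, C, hC⟩ := hg
  obtain ⟨D, hD⟩ := hφ (M + 2 * n)
  have hC0 : 0 ≤ C := by simpa using (norm_nonneg _).trans (hC 0)
  refine .of_nonneg_of_le (fun k => norm_nonneg _) (fun k => ?_)
    (((Equiv.subRight m).summable_iff.2 (summable_inv_one_add_norm_pow n)).mul_left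
      (C * (1 + ‖m‖) ^ M * D))
  have hk : 1 + ‖k‖ ≤ (1 + ‖m‖) * (1 + ‖k - m‖) := by
    nlinarith [norm_le_norm_add_norm_sub' k m, norm_nonneg m, norm_nonneg (k - m)]
  rw [norm_mul, RCLike.norm_conj, Function.comp_apply, Equiv.subRight_apply, ← div_eq_mul_inv,
    le_div_iff₀ (by positivity)]
  calc ‖g k‖ * ‖φ (k - m)‖ * (1 + ‖k - m‖) ^ (2 * n)
      ≤ C * ((1 + ‖m‖) * (1 + ‖k - m‖)) ^ M * ‖φ (k - m)‖ * (1 + ‖k - m‖) ^ (2 * n) := by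
        gcongr
        exact (hC k).trans (by gcongr)
    _ = C * (1 + ‖m‖) ^ M * ((1 + ‖k - m‖) ^ (M + 2 * n) * ‖φ (k - m)‖) := by
        rw [mul_pow]
        ring
    _ ≤ C * (1 + ‖m‖) ^ M * D := by
        gcongr
        exact hD (k - m)

theorem enorm_mul_le_lintegral_stftZ (hφ : IsSchwartzZ φ) (hg : IsTemperedZ g) (k m : Zn n) :
    ‖g (k + m)‖ₑ * ‖φ k‖ₑ ≤ ∫⁻ w, ‖stftZ φ g (m, w)‖ₑ ∂haarT n := by
  have hsum := summable_norm_mul_conj_sub hφ hg m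
  have h : ‖g (k + m) * starRingEnd ℂ (φ (k + m - m))‖ₑ ≤
      ∫⁻ w, ‖stftZ φ g (m, w)‖ₑ ∂haarT n := by
    refine enorm_coeff_le_lintegral_of_hasSum (χ := fun j => chr (-j))
      (b := fun j => g j * starRingEnd ℂ (φ (j - m)))
      (fun j => (continuous_chr _).aestronglyMeasurable) (fun j w => (norm_chr _ w).le) ?_
      (fun j hj => ?_) hsum fun w => ?_
    · simp only [conj_chr_mul_chr, sub_self, integral_chr, if_true]
    · simp only [conj_chr_mul_chr, integral_chr]
      rw [if_neg (sub_ne_zero.2 (neg_injective.ne hj))]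
    · refine (hsum.of_norm_bounded fun j => ?_).hasSum_iff.2 (tsum_congr fun j => ?_)
      · rw [norm_mul _ (chr _ _), norm_chr, mul_one]
      · rw [shiftZ, map_mul, chr_neg]
        ring
  rwa [add_sub_cancel_right, enorm_mul, RCLike.enorm_conj] at h

theorem summable_norm_of_memModulationZ (hφ : IsSchwartzZ φ) (hφ0 : φ ≠ 0)
    (hg : MemModulationZ φ 1 g) : Summable fun k => ‖g k‖ := by
  obtain ⟨k, hk⟩ := Function.ne_iff.1 hφ0
  have hle : (∑' m, ‖g (k + m)‖ₑ) * ‖φ k‖ₑ ≤ eLpNorm (stftZ φ g) 1 (haarZT n) := by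
    rw [← ENNReal.tsum_mul_right, eLpNorm_one_eq_lintegral_enorm, haarZT,
      lintegral_prod _ hg.2.1.enorm, lintegral_count]
    exact ENNReal.tsum_le_tsum (enorm_mul_le_lintegral_stftZ hφ hg.1 k)
  have hfin : ∑' m, ‖g (k + m)‖ₑ ≠ ⊤ :=
    (ENNReal.lt_top_of_mul_ne_top_left (hle.trans_lt hg.2.2).ne (enorm_ne_zero.2 hk)).ne
  exact (Equiv.addLeft k).summable_iff.1 (tsum_enorm_ne_top_iff_summable_norm.1 hfin)

end Windows

/-! ### Approximation by Schwartz functions -/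

section Count

variable {α : Type*} [MeasurableSpace α] [MeasurableSingletonClass α] {p : ENNReal}

theorem norm_le_toReal_eLpNorm_count (hp : p ≠ 0) {c : α → ℂ}
    (hc : eLpNorm c p Measure.count ≠ ⊤) (a : α) : ‖c a‖ ≤ (eLpNorm c p Measure.count).toReal := by
  rw [← toReal_enorm]
  exact ENNReal.toReal_mono hc (enorm_le_eLpNorm_count c a hp)

theorem enorm_lp_top_le_eLpNorm_count (hp : p ≠ 0) (c : lp (fun _ : α => ℂ) ⊤) :
    ‖c‖ₑ ≤ eLpNorm c p Measure.count := by
  by_cases hc : eLpNorm c p Measure.count = ⊤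
  · rw [hc]
    exact le_top
  · rw [← ofReal_norm, ENNReal.ofReal_le_iff_le_toReal hc]
    exact lp.norm_le_of_forall_le ENNReal.toReal_nonneg (norm_le_toReal_eLpNorm_count hp hc)

theorem memℓp_top_of_memLp_count (hp : p ≠ 0) {c : α → ℂ} (hc : MemLp c p Measure.count) :
    Memℓp c ⊤ :=
  memℓp_infty ⟨_, Set.forall_mem_range.2 (norm_le_toReal_eLpNorm_count hp hc.2.ne)⟩

theorem tendsto_eLpNorm_indicator_sub (hp0 : p ≠ 0) (hp : p ≠ ⊤) {c : α → ℂ}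
    (hc : MemLp c p Measure.count) :
    Filter.Tendsto (fun s : Finset α => eLpNorm ((s : Set α).indicator c - c) p Measure.count)
      Filter.atTop (nhds 0) := by
  have hpos : 0 < p.toReal := ENNReal.toReal_pos hp0 hp
  have hsum : ∑' a, ‖c a‖ₑ ^ p.toReal ≠ ⊤ := by
    rw [← lintegral_count]
    exact ((eLpNorm_lt_top_iff_lintegral_rpow_enorm_lt_top hp0 hp).1 hc.2).ne
  have htail := (ENNReal.continuous_rpow_const (y := 1 / p.toReal)).tendsto 0 |>.comp
    (ENNReal.tendsto_tsum_compl_atTop_zero hsum)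
  rw [ENNReal.zero_rpow_of_pos (by positivity)] at htail
  refine htail.congr fun s => ?_
  rw [eLpNorm_eq_lintegral_rpow_enorm_toReal hp0 hp, lintegral_count, Function.comp_apply]
  congr 1
  refine (tsum_subtype (s : Set α)ᶜ fun a => ‖c a‖ₑ ^ p.toReal).trans (tsum_congr fun a => ?_)
  by_cases ha : a ∈ s
  · simp [ha, hpos]
  · simp [ha]

theorem memLp_indicator_finset_count {α : Type*} [MeasurableSpace α] [DiscreteMeasurableSpace α]
    (s : Finset α) (c : α → ℂ) (p : ENNReal) :
    MemLp ((s : Set α).indicator c) p Measure.count := by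
  rw [memLp_indicator_iff_restrict s.measurableSet]
  have : IsFiniteMeasure (Measure.count.restrict (s : Set α)) :=
    isFiniteMeasure_restrict.2 (Measure.count_apply_lt_top.2 s.finite_toSet).ne
  exact .of_bound Measurable.of_discrete.aestronglyMeasurable (∑ a ∈ s, ‖c a‖)
    (ae_restrict_of_forall_mem s.measurableSet fun a ha =>
      Finset.single_le_sum (f := fun a => ‖c a‖) (fun _ _ => norm_nonneg _) ha)

end Count

section Approximation

variable {n : ℕ} {Φ : SchwartzZT n} {σ τ : SchwartzZT n →ₗ[ℂ] ℂ} {p : ENNReal}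

theorem measurable_schwartzZT (ψ : SchwartzZT n) : Measurable ψ.1 :=
  measurable_from_prod_countable_right fun m => (continuous_slice ψ m).measurable

theorem integrable_schwartzZT (ψ : SchwartzZT n) : Integrable ψ.1 (haarZT n) := by
  obtain ⟨C, hC⟩ := exists_norm_schwartzZT_le ψ (2 * n)
  have hdom : Integrable (fun m : Zn n => C / (1 + ‖m‖) ^ (2 * n)) Measure.count :=
    integrable_count_iff.2 ((summable_inv_one_add_norm_pow n).mul_left C).norm
  exact (hdom.comp_fst (haarT n)).mono' (measurable_schwartzZT ψ).aestronglyMeasurable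
    (.of_forall hC)

theorem integrable_mul_schwartzZT {u : Zn n × Tn n → ℂ} (hu : Integrable u (haarZT n))
    (ψ : SchwartzZT n) : Integrable (fun z => u z * ψ.1 z) (haarZT n) := by
  obtain ⟨C, hC⟩ := exists_norm_schwartzZT_le ψ 0
  exact hu.mul_bdd (c := C) (measurable_schwartzZT ψ).aestronglyMeasurable
    (.of_forall fun z => by simpa using hC z)

/-- The Schwartz function `ψ` as a distribution. -/
def regularZT : SchwartzZT n →ₗ[ℂ] SchwartzZT n →ₗ[ℂ] ℂ :=
  LinearMap.mk₂ ℂ (fun ψ φ => ∫ z, ψ.1 z * φ.1 z ∂haarZT n)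
    (fun ψ ψ' φ => by
      rw [← integral_add (integrable_mul_schwartzZT (integrable_schwartzZT ψ) φ)
        (integrable_mul_schwartzZT (integrable_schwartzZT ψ') φ)]
      exact integral_congr_ae (.of_forall fun z => add_mul _ _ _))
    (fun a ψ φ => by
      rw [smul_eq_mul, ← integral_const_mul]
      exact integral_congr_ae (.of_forall fun z => mul_assoc _ _ _))
    (fun ψ φ φ' => by
      rw [← integral_add (integrable_mul_schwartzZT (integrable_schwartzZT ψ) φ)
        (integrable_mul_schwartzZT (integrable_schwartzZT ψ) φ')]
      exact integral_congr_ae (.of_forall fun z => mul_add _ _ _))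
    (fun a ψ φ => by
      rw [smul_eq_mul, ← integral_const_mul]
      exact integral_congr_ae (.of_forall fun z => mul_left_comm _ _ _))

theorem isRegular_regularZT (ψ : SchwartzZT n) : IsRegular (regularZT ψ) ψ.1 :=
  ⟨integrable_schwartzZT ψ, fun _ => rfl⟩

theorem IsRegular.isTemperedZT {u : Zn n × Tn n → ℂ} (h : IsRegular τ u) : IsTemperedZT τ := by
  refine ⟨0, ∫ z, ‖u z‖ ∂haarZT n, fun φ b hb => ?_⟩
  have hφ (z : Zn n × Tn n) : ‖φ.1 z‖ ≤ b := norm_le_of_forall_norm_lift_le (fun x => by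
    simpa only [pow_zero, one_mul, norm_iteratedFDeriv_zero] using hb 0 le_rfl 0 le_rfl z.1 x) z.2
  rw [h.2, ← integral_mul_const]
  refine norm_integral_le_of_norm_le (h.1.norm.mul_const b) (.of_forall fun z => ?_)
  rw [norm_mul]
  exact mul_le_mul_of_nonneg_left (hφ z) (norm_nonneg _)

theorem IsRegular.coeffZT_eq_integral {u : Zn n × Tn n → ℂ} (h : IsRegular τ u) (m j : Zn n) :
    coeffZT τ (m, j) = ∫ w, u (m, w) * chr (-j) w ∂haarT n := by
  have hint : Integrable (fun z => u z * (tensorZT m (-j)).1 z) (Measure.count.prod (haarT n)) :=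
    integrable_mul_schwartzZT h.1 (tensorZT m (-j))
  rw [coeffZT, h.2, haarZT, integral_prod _ hint, integral_countable hint.integral_prod_left,
    tsum_eq_single m fun k hk => ?_]
  · simp only [tensorZT_apply, if_true, Measure.real, Measure.count_singleton, ENNReal.toReal_one,
      one_smul]
  · simp only [tensorZT_apply, if_neg hk, mul_zero, integral_zero, smul_zero]

theorem coeffZT_regularZT_tensorZT (q r : Zn n × Zn n) :
    coeffZT (regularZT (tensorZT q.1 q.2)) r = if r = q then 1 else 0 := by
  rw [← Prod.mk.eta (p := r), (isRegular_regularZT _).coeffZT_eq_integral]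
  by_cases h : r.1 = q.1
  · simp only [tensorZT_apply, h, if_true, chr_neg, mul_comm (chr q.2 _), conj_chr_mul_chr,
      integral_chr, sub_eq_zero, Prod.ext_iff, true_and, eq_comm]
  · simp only [tensorZT_apply, h, if_false, zero_mul, integral_zero, Prod.ext_iff, false_and]

/-- The partial sum over `s` of the Fourier series of `σ` in the torus variable. -/
def fourierPartialSum (σ : SchwartzZT n →ₗ[ℂ] ℂ) (s : Finset (Zn n × Zn n)) : SchwartzZT n :=
  ∑ q ∈ s, coeffZT σ q • tensorZT q.1 q.2

theorem coeffZT_regularZT_fourierPartialSum (σ : SchwartzZT n →ₗ[ℂ] ℂ)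
    (s : Finset (Zn n × Zn n)) :
    coeffZT (regularZT (fourierPartialSum σ s)) =
      (s : Set (Zn n × Zn n)).indicator (coeffZT σ) := by
  ext r
  calc coeffZT (regularZT (fourierPartialSum σ s)) r
      = ∑ q ∈ s, coeffZT σ q * coeffZT (regularZT (tensorZT q.1 q.2)) r := by
        simp only [coeffZT, fourierPartialSum, map_sum, map_smul, LinearMap.sum_apply,
          LinearMap.smul_apply, smul_eq_mul]
    _ = _ := by
        simp only [coeffZT_regularZT_tensorZT, mul_ite, mul_one, mul_zero, Finset.sum_ite_eq,
          Set.indicator_apply, Finset.mem_coe]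

theorem tsum_enorm_fourierZT_ne_top (Φ : SchwartzZT n) : ∑' q, ‖fourierZT Φ q‖ₑ ≠ ⊤ :=
  tsum_enorm_ne_top_iff_summable_norm.2 (summable_norm_fourierZT Φ)

theorem IsTemperedZT.memModulationZT (hσ : IsTemperedZT σ) (Φ : SchwartzZT n) (hp : 1 ≤ p)
    (hc : MemLp (coeffZT σ) p Measure.count) : MemModulationZT Φ p σ :=
  ⟨hσ, (hσ.measurable_stftZT Φ).aestronglyMeasurable, (hσ.modulationNormZT_le Φ hp).trans_lt
    (ENNReal.mul_lt_top (tsum_enorm_fourierZT_ne_top Φ).lt_top hc.2)⟩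

theorem MemModulationZT.memLp_coeffZT (hσ : MemModulationZT Φ p σ) (hΦ : Φ ≠ 0) (hp1 : 1 ≤ p)
    (hp : p ≠ ⊤) : MemLp (coeffZT σ) p Measure.count := by
  obtain ⟨r, hr⟩ := exists_fourierZT_ne_zero hΦ
  exact ⟨(measurable_of_countable _).aestronglyMeasurable, ENNReal.lt_top_of_mul_ne_top_right
    ((hσ.1.enorm_mul_eLpNorm_coeffZT_le Φ r hp1 hp).trans_lt hσ.2.2).ne (enorm_ne_zero.2 hr)⟩

theorem tendsto_modulationNormZT_fourierPartialSum (hΦ : Φ ≠ 0) (hp1 : 1 ≤ p) (hp : p ≠ ⊤)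
    (hσ : MemModulationZT Φ p σ) :
    Filter.Tendsto (fun s => modulationNormZT Φ p (regularZT (fourierPartialSum σ s) - σ))
      Filter.atTop (nhds 0) := by
  have hlim := ENNReal.Tendsto.const_mul (tendsto_eLpNorm_indicator_sub
    (zero_lt_one.trans_le hp1).ne' hp (hσ.memLp_coeffZT hΦ hp1 hp))
    (.inr (tsum_enorm_fourierZT_ne_top Φ))
  rw [mul_zero] at hlim
  refine tendsto_of_tendsto_of_tendsto_of_le_of_le tendsto_const_nhds hlim (fun _ => zero_le)
    fun s => ?_
  have hle := ((isRegular_regularZT (fourierPartialSum σ s)).isTemperedZT.sub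
    hσ.1).modulationNormZT_le Φ hp1
  rwa [coeffZT_sub, coeffZT_regularZT_fourierPartialSum] at hle

theorem exists_approximates (hΦ : Φ ≠ 0) (hp1 : 1 ≤ p) (hp : p ≠ ⊤)
    (hσ : MemModulationZT Φ p σ) : ∃ u, Approximates Φ p u σ := by
  obtain ⟨s, hs⟩ := Filter.exists_seq_tendsto (Filter.atTop : Filter (Finset (Zn n × Zn n)))
  have hmem (i : ℕ) {q : ENNReal} (hq : 1 ≤ q) :
      MemModulationZT Φ q (regularZT (fourierPartialSum σ (s i))) := by
    refine (isRegular_regularZT _).isTemperedZT.memModulationZT Φ hq ?_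
    rw [coeffZT_regularZT_fourierPartialSum]
    exact memLp_indicator_finset_count _ _ _
  exact ⟨_, _, fun i => ⟨isRegular_regularZT _, hmem i le_rfl, hmem i le_top⟩,
    (tendsto_modulationNormZT_fourierPartialSum hΦ hp1 hp hσ).comp hs⟩

end Approximation

section LocOp

variable {n : ℕ} {Φ : SchwartzZT n} {σ : SchwartzZT n →ₗ[ℂ] ℂ} {p : ENNReal} {ι : Type*}
  {l : Filter ι} {g₁ g₂ : Zn n → ℂ}

theorem tendsto_eLpNorm_coeffZT {τ : ι → SchwartzZT n →ₗ[ℂ] ℂ} (hΦ : Φ ≠ 0) (hp1 : 1 ≤ p)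
    (hp : p ≠ ⊤) (hτ : ∀ i, IsTemperedZT (τ i))
    (hlim : Filter.Tendsto (fun i => modulationNormZT Φ p (τ i)) l (nhds 0)) :
    Filter.Tendsto (fun i => eLpNorm (coeffZT (τ i)) p Measure.count) l (nhds 0) := by
  obtain ⟨r, hr⟩ := exists_fourierZT_ne_zero hΦ
  have hr0 : ‖fourierZT Φ r‖ₑ ≠ 0 := enorm_ne_zero.2 hr
  have h := ENNReal.Tendsto.const_mul hlim (.inr (ENNReal.inv_ne_top.2 hr0))
  rw [mul_zero] at h
  refine tendsto_of_tendsto_of_tendsto_of_le_of_le tendsto_const_nhds h (fun _ => zero_le)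
    fun i => (ENNReal.mul_le_iff_le_inv hr0 enorm_ne_top).1 ?_
  exact (hτ i).enorm_mul_eLpNorm_coeffZT_le Φ r hp1 hp

theorem MemModulationZT.memℓp_coeffZT (hσ : MemModulationZT Φ p σ) (hΦ : Φ ≠ 0) (hp1 : 1 ≤ p)
    (hp : p ≠ ⊤) : Memℓp (coeffZT σ) ⊤ :=
  memℓp_top_of_memLp_count (zero_lt_one.trans_le hp1).ne' (hσ.memLp_coeffZT hΦ hp1 hp)

/-- The localization operator with windows `g₁, g₂` whose symbol is a distribution `σ` with bounded
Fourier coefficients. -/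
def locOp (g₁ g₂ : Zn n → ℂ) (σ : SchwartzZT n →ₗ[ℂ] ℂ) (hσ : Memℓp (coeffZT σ) ⊤) :
    ell2 n →L[ℂ] ell2 n :=
  coeffLocOp g₁ g₂ ⟨coeffZT σ, hσ⟩

theorem isLocOpFun_locOp (h₁ : Summable fun k => ‖g₁ k‖) (h₂ : Summable fun k => ‖g₂ k‖)
    {u : Zn n × Tn n → ℂ} (hu : IsRegular σ u) (hσ : Memℓp (coeffZT σ) ⊤) :
    IsLocOpFun g₁ g₂ u (locOp g₁ g₂ σ hσ) :=
  isLocOpFun_coeffLocOp h₁ h₂ hu.1 hu.coeffZT_eq_integral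

theorem isTraceClass_locOp (h₁ : Summable fun k => ‖g₁ k‖) (h₂ : Summable fun k => ‖g₂ k‖)
    (hΦ : Φ ≠ 0) (hσ : MemModulationZT Φ 1 σ) (hσ' : Memℓp (coeffZT σ) ⊤) :
    IsTraceClass (locOp g₁ g₂ σ hσ') := by
  have hsum : Summable fun q => ‖coeffZT σ q‖ := integrable_count_iff.1
    (memLp_one_iff_integrable.1 (hσ.memLp_coeffZT hΦ le_rfl ENNReal.one_ne_top))
  exact isTraceClass_coeffLocOp (c := ⟨coeffZT σ, hσ'⟩) hsum h₁ h₂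

theorem tendsto_locOp (h₁ : Summable fun k => ‖g₁ k‖) (h₂ : Summable fun k => ‖g₂ k‖)
    (hΦ : Φ ≠ 0) (hp1 : 1 ≤ p) (hp : p ≠ ⊤) {τ : ι → SchwartzZT n →ₗ[ℂ] ℂ}
    (hτ : ∀ i, IsTemperedZT (τ i)) (hσ : IsTemperedZT σ) (hτ' : ∀ i, Memℓp (coeffZT (τ i)) ⊤)
    (hσ' : Memℓp (coeffZT σ) ⊤)
    (hlim : Filter.Tendsto (fun i => modulationNormZT Φ p (τ i - σ)) l (nhds 0)) :
    Filter.Tendsto (fun i => locOp g₁ g₂ (τ i) (hτ' i)) l (nhds (locOp g₁ g₂ σ hσ')) := by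
  have hcoeff := tendsto_eLpNorm_coeffZT hΦ hp1 hp (fun i => (hτ i).sub hσ) hlim
  refine ((continuous_coeffLocOp h₁ h₂).tendsto ⟨coeffZT σ, hσ'⟩).comp
    (tendsto_iff_edist_tendsto_0.2 ?_)
  refine tendsto_of_tendsto_of_tendsto_of_le_of_le tendsto_const_nhds hcoeff (fun _ => zero_le)
    fun i => ?_
  rw [edist_eq_enorm_sub]
  exact enorm_lp_top_le_eLpNorm_count (zero_lt_one.trans_le hp1).ne' _

theorem isLocOp_locOp (h₁ : Summable fun k => ‖g₁ k‖) (h₂ : Summable fun k => ‖g₂ k‖)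
    (hΦ : Φ ≠ 0) (hp1 : 1 ≤ p) (hp : p ≠ ⊤) (hσ : MemModulationZT Φ p σ)
    (hσ' : Memℓp (coeffZT σ) ⊤) : IsLocOp Φ p g₁ g₂ σ (locOp g₁ g₂ σ hσ') := by
  refine ⟨exists_approximates hΦ hp1 hp hσ, fun u ⟨τ, hτ, hlim⟩ => ?_⟩
  have hτ' (i : ℕ) : Memℓp (coeffZT (τ i)) ⊤ :=
    (hτ i).2.1.memℓp_coeffZT hΦ le_rfl ENNReal.one_ne_top
  exact ⟨fun i => locOp g₁ g₂ (τ i) (hτ' i), fun i => isLocOpFun_locOp h₁ h₂ (hτ i).1 (hτ' i),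
    tendsto_locOp h₁ h₂ hΦ hp1 hp (fun i => (hτ i).2.1.1) hσ.1 hτ' hσ' hlim⟩

theorem IsLocOp.unique {A B : ell2 n →L[ℂ] ell2 n} (hA : IsLocOp Φ p g₁ g₂ σ A)
    (hB : IsLocOp Φ p g₁ g₂ σ B) : A = B := by
  obtain ⟨u, hu⟩ := hA.1
  obtain ⟨A', hA', hlimA⟩ := hA.2 u hu
  obtain ⟨B', hB', hlimB⟩ := hB.2 u hu
  obtain rfl : A' = B' := funext fun i => (hA' i).unique (hB' i)
  exact tendsto_nhds_unique hlimA hlimB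

theorem isCompactOperator_locOp (h₁ : Summable fun k => ‖g₁ k‖) (h₂ : Summable fun k => ‖g₂ k‖)
    (hΦ : Φ ≠ 0) (hp1 : 1 ≤ p) (hp : p ≠ ⊤) (hσ : MemModulationZT Φ p σ)
    (hσ' : Memℓp (coeffZT σ) ⊤) : IsCompactOperator (locOp g₁ g₂ σ hσ') := by
  obtain ⟨u, τ, hτ, hlim⟩ := exists_approximates hΦ hp1 hp hσ
  have hτ' (i : ℕ) : Memℓp (coeffZT (τ i)) ⊤ :=
    (hτ i).2.1.memℓp_coeffZT hΦ le_rfl ENNReal.one_ne_top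
  exact isCompactOperator_of_tendsto
    (tendsto_locOp h₁ h₂ hΦ hp1 hp (fun i => (hτ i).2.1.1) hσ.1 hτ' hσ' hlim)
    (.of_forall fun i => (isTraceClass_locOp h₁ h₂ hΦ (hτ i).2.1 (hτ' i)).1)

end LocOp

end

end DiscreteLoc

theorem mainTheorem2 (n : ℕ)
    (φ : Zn n → ℂ) (hφ : IsSchwartzZ φ) (hφ0 : φ ≠ 0)
    (Φ : SchwartzZT n) (hΦ0 : Φ ≠ 0)
    (p : ENNReal) (hp1 : 1 ≤ p) (hp : p < ⊤)
    (σ : SchwartzZT n →ₗ[ℂ] ℂ) (hσ : MemModulationZT Φ p σ)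
    (g₁ g₂ : Zn n → ℂ) (hg₁ : MemModulationZ φ 1 g₁) (hg₂ : MemModulationZ φ 1 g₂) :
    ∃ A : ell2 n →L[ℂ] ell2 n,
      (∀ A', IsLocOp Φ p g₁ g₂ σ A' ↔ A' = A) ∧
      IsCompactOperator A ∧
      (MemModulationZT Φ 1 σ → IsTraceClass A) := by
  have h₁ := summable_norm_of_memModulationZ hφ hφ0 hg₁
  have h₂ := summable_norm_of_memModulationZ hφ hφ0 hg₂
  have hσ' := hσ.memℓp_coeffZT hΦ0 hp1 hp.ne
  have hloc : IsLocOp Φ p g₁ g₂ σ (locOp g₁ g₂ σ hσ') :=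
    isLocOp_locOp h₁ h₂ hΦ0 hp1 hp.ne hσ hσ'
  exact ⟨locOp g₁ g₂ σ hσ', fun A' => ⟨fun hA' => hA'.unique hloc, fun h => h ▸ hloc⟩,
    isCompactOperator_locOp h₁ h₂ hΦ0 hp1 hp.ne hσ hσ',
    fun hσ1 => isTraceClass_locOp h₁ h₂ hΦ0 hσ1 hσ'⟩
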